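/- Let $(T,\Sigma,\mu)$ be a non-atomic, $\sigma$-finite measure space, and let $\Phi\colon T\times[0,\infty]\to[0,\infty]$ be a Musielak--Orlicz function: for $\mu$-a.e. $t$, $\Phi(t,\cdot)$ is convex and lower semi-continuous with $\Phi(t,0)=\lim_{u\downarrow0}\Phi(t,u)=0$ and $\Phi(t,\infty)=\infty$, and for every $u\ge 0$ the function $\Phi(\cdot,u)$ is measurable (up to a null set). Let $L^0$ be the space of real measurable functions on $T$ modulo a.e. equality; all relations between functions below are understood a.e. Put $$\Phi^*(t,v)=\sup_{u>0}(uv-\Phi(t,u)),\qquad I_\Phi(u)=\int_T\Phi(t,|u(t)|)\,d\mu,$$ $$L^\Phi=\{u\in L^0: I_\Phi(\lambda u)<\infty\text{ for some }\lambda>0\},\qquad \tilde L^\Phi=\{u\in L^0: I_\Phi(u)<\infty\},$$ with the Luxemburg and Orlicz norms $$\|u\|_\Phi=\inf\{\lambda>0: I_\Phi(u/\lambda)\le1\},\qquad \|u\|_{\Phi,0}=\sup\Bigl\{\Bigl|\int_T uv\,d\mu\Bigr| : v\in L^0,\ I_{\Phi^*}(v)\le1\Bigr\},$$ and for $u\in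 L^\Phi$ $$\theta_\Phi(u)=\inf\{\lambda>0: I_\Phi(u/\lambda)<\infty\},$$ $$Q_\Phi(u)=\sup\{\inf_{n}\|u_n\|_\Phi: |u|\ge u_n\downarrow0\},\qquad Q_{\Phi,0}(u)=\sup\{\inf_{n}\|u_n\|_{\Phi,0}: |u|\ge u_n\downarrow0\},$$ where $u_n\downarrow 0$ ($u_n\uparrow u$) means that the sequence is non-increasing (non-decreasing) and converges a.e. to $0$ (to $u$). Let $(L^\Phi)^*$ be the space of linear functionals $f\colon L^\Phi\to\mathbb R$ that are bounded with respect to $\|\cdot\|_\Phi$, and for $f\in(L^\Phi)^*$ let $$\|f\|_0=\sup_{u\in L^\Phi}\frac{|f(u)|}{\|u\|_\Phi},\qquad \|f\|=\sup_{u\in L^\Phi}\frac{|f(u)|}{\|u\|_{\Phi,0}}.$$ In these and the following suprema, which are taken in $[0,\infty]$, we put $0/0=0$ and $a/0=\infty$ for $a>0$. The order continuous component of a positive $g\in(L^\Phi)^*$ is given for $u\ge0$ in $L^\Phi$ by $g_{\mathrm c}(u)=\inf\{\sup_n g(u_n):0\le u_n\uparrow u,\ u_n\in L^\Phi\}$.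 For general $f\in(L^\Phi)^*$ and $u\ge 0$ in $L^\Phi$, $f_{\mathrm c}(u)=(f^+)_{\mathrm c}(u)-(f^-)_{\mathrm c}(u)$, where $f^+(u)=\sup\{f(w):w\in L^\Phi,\ 0\le w\le u\}$ and $f^-=(-f)^+$. The functional $f$ is called purely singular if $f_{\mathrm c}=0$. If $f\in(L^\Phi)^*$ is purely singular, then $$\|f\|_0=\sup_{u\in L^\Phi}\frac{|f(u)|}{Q_\Phi(u)},\qquad \|f\|=\sup_{u\in L^\Phi}\frac{|f(u)|}{Q_{\Phi,0}(u)},$$ and $$\|f\|_0=\|f\|=\sup_{u\in\tilde L^\Phi}|f(u)|=\sup_{u\in L^\Phi}\frac{|f(u)|}{\theta_\Phi(u)}.$$ -/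

import Mathlib

open MeasureTheory Filter Set
open scoped ENNReal NNReal Topology

namespace MusielakOrlicz

/-- The measure `μ` is non-atomic: every measurable set of positive measure has a measurable
subset of strictly smaller positive measure. (Mathlib's `NoAtoms` only speaks about points.) -/
def NonAtomic {T : Type*} [MeasurableSpace T] (μ : Measure T) : Prop :=
  ∀ A : Set T, MeasurableSet A → 0 < μ A →
    ∃ B : Set T, MeasurableSet B ∧ B ⊆ A ∧ 0 < μ B ∧ μ B < μ A

/-- `Φ : T × [0,∞] → [0,∞]` is a Musielak–Orlicz function. As the defining conditions are only
required for almost every `t`, measurability in `t` is required up to a null set. -/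
structure IsMusielakOrlicz {T : Type*} [MeasurableSpace T] (μ : Measure T)
    (Φ : T → ℝ≥0∞ → ℝ≥0∞) : Prop where
  convex : ∀ᵐ t ∂μ, ConvexOn ℝ≥0 Set.univ (Φ t)
  lsc : ∀ᵐ t ∂μ, LowerSemicontinuous (Φ t)
  map_zero : ∀ᵐ t ∂μ, Φ t 0 = 0
  tendsto_zero : ∀ᵐ t ∂μ, Tendsto (Φ t) (𝓝[>] 0) (𝓝 0)
  map_top : ∀ᵐ t ∂μ, Φ t ∞ = ∞
  measurable : ∀ u : ℝ≥0∞, AEMeasurable (fun t => Φ t u) μ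

/-- The complementary function `Φ*(t,v) = sup_{u > 0} (u v - Φ(t,u))`. The subtraction of `ℝ≥0∞`
is truncated at `0`, which does not change the supremum, because `Φ(t,u) → 0` as `u ↓ 0`. -/
noncomputable def compl {T : Type*} (Φ : T → ℝ≥0∞ → ℝ≥0∞) : T → ℝ≥0∞ → ℝ≥0∞ :=
  fun t v => ⨆ (u : ℝ≥0) (_ : 0 < u), ((u : ℝ≥0∞) * v - Φ t u)

section Modular

variable {T : Type*} [MeasurableSpace T] {μ : Measure T} (Φ : T → ℝ≥0∞ → ℝ≥0∞)

/-- `I_Φ(u) = ∫ Φ(t,|u(t)|) dμ`, for `u` in `L⁰`, the space `T →ₘ[μ] ℝ` of measurable functions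
modulo equality almost everywhere. -/
noncomputable def modular (u : T →ₘ[μ] ℝ) : ℝ≥0∞ := ∫⁻ t, Φ t ‖u t‖ₑ ∂μ

/-- The Luxemburg norm `inf {r > 0 : I_Φ(u / r) ≤ 1}`. -/
noncomputable def luxNorm (u : T →ₘ[μ] ℝ) : ℝ≥0∞ :=
  ⨅ (r : ℝ) (_ : 0 < r) (_ : modular Φ (r⁻¹ • u) ≤ 1), ENNReal.ofReal r

/-- The Orlicz norm `sup {|∫ u v dμ| : I_{Φ*}(v) ≤ 1}`; for `u` in `L^Φ` all the products `u v`
are integrable. -/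
noncomputable def orliczNorm (u : T →ₘ[μ] ℝ) : ℝ≥0∞ :=
  ⨆ (v : T →ₘ[μ] ℝ) (_ : modular (compl Φ) v ≤ 1), ‖∫ t, u t * v t ∂μ‖ₑ

/-- `θ_Φ(u) = inf {r > 0 : I_Φ(u / r) < ∞}`. -/
noncomputable def theta (u : T →ₘ[μ] ℝ) : ℝ≥0∞ :=
  ⨅ (r : ℝ) (_ : 0 < r) (_ : modular Φ (r⁻¹ • u) < ∞), ENNReal.ofReal r

/-- `w_n ↓ 0`: the sequence is non-increasing and converges to `0`, almost everywhere. -/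
def DecreasesToZero (w : ℕ → T →ₘ[μ] ℝ) : Prop :=
  Antitone w ∧ ∀ᵐ t ∂μ, Tendsto (fun n => w n t) atTop (𝓝 0)

/-- `w_n ↑ u`: the sequence is non-decreasing and converges to `u`, almost everywhere. -/
def IncreasesTo (w : ℕ → T →ₘ[μ] ℝ) (u : T →ₘ[μ] ℝ) : Prop :=
  Monotone w ∧ ∀ᵐ t ∂μ, Tendsto (fun n => w n t) atTop (𝓝 (u t))

/-- `Q_Φ(u) = sup {inf_n ‖u_n‖_Φ : |u| ≥ u_n ↓ 0}`. -/
noncomputable def qLux (u : T →ₘ[μ] ℝ) : ℝ≥0∞ :=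
  ⨆ (w : ℕ → T →ₘ[μ] ℝ) (_ : ∀ n, w n ≤ |u|) (_ : DecreasesToZero w), ⨅ n, luxNorm Φ (w n)

/-- `Q_{Φ,0}(u) = sup {inf_n ‖u_n‖_{Φ,0} : |u| ≥ u_n ↓ 0}`. -/
noncomputable def qOrlicz (u : T →ₘ[μ] ℝ) : ℝ≥0∞ :=
  ⨆ (w : ℕ → T →ₘ[μ] ℝ) (_ : ∀ n, w n ≤ |u|) (_ : DecreasesToZero w), ⨅ n, orliczNorm Φ (w n)

end Modular

section Space

variable {T : Type*} [MeasurableSpace T] {μ : Measure T} {Φ : T → ℝ≥0∞ → ℝ≥0∞}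

theorem mono_of_convex {g : ℝ≥0∞ → ℝ≥0∞} (hc : ConvexOn ℝ≥0 Set.univ g) (h0 : g 0 = 0)
    (ht : g ∞ = ∞) : Monotone g := by
  intro x y hxy
  rcases eq_or_ne y ∞ with rfl | hy
  · rw [ht]; exact le_top
  have hx : x ≠ ∞ := ne_top_of_le_ne_top hy hxy
  lift x to ℝ≥0 using hx
  lift y to ℝ≥0 using hy
  have hxy' : x ≤ y := by exact_mod_cast hxy
  rcases eq_or_ne y 0 with rfl | hy0
  · have : x = 0 := le_antisymm hxy' zero_le
    rw [this]
  have hs : x / y ≤ 1 := div_le_one_of_le₀ hxy' zero_le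
  have key := hc.2 (Set.mem_univ (y : ℝ≥0∞)) (Set.mem_univ (0 : ℝ≥0∞)) (zero_le : 0 ≤ x / y)
    (zero_le : 0 ≤ 1 - x / y) (add_tsub_cancel_of_le hs)
  have e : (x / y : ℝ≥0) • (y : ℝ≥0∞) = (x : ℝ≥0∞) := by
    rw [ENNReal.smul_def, smul_eq_mul, ← ENNReal.coe_mul, div_mul_cancel₀ _ hy0]
  rw [smul_zero, add_zero, h0, smul_zero, add_zero, e] at key
  refine key.trans ?_
  rw [ENNReal.smul_def, smul_eq_mul]
  calc ((x / y : ℝ≥0) : ℝ≥0∞) * g y ≤ 1 * g y := by gcongr; exact_mod_cast hs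
    _ = g y := one_mul _

theorem IsMusielakOrlicz.ae_mono (hΦ : IsMusielakOrlicz μ Φ) : ∀ᵐ t ∂μ, Monotone (Φ t) := by
  filter_upwards [hΦ.convex, hΦ.map_zero, hΦ.map_top] with t h1 h2 h3
  exact mono_of_convex h1 h2 h3

theorem IsMusielakOrlicz.aemeasurable_comp (hΦ : IsMusielakOrlicz μ Φ) (u : T →ₘ[μ] ℝ) :
    AEMeasurable (fun t => Φ t ‖u t‖ₑ) μ := by
  have hu : Measurable fun t => ‖u t‖ₑ := u.measurable.enorm
  have hm : AEMeasurable (fun t => ⨆ q : ℚ,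
      {t | ENNReal.ofReal q ≤ ‖u t‖ₑ}.indicator (fun t => Φ t (ENNReal.ofReal q)) t) μ :=
    AEMeasurable.iSup fun q => (hΦ.measurable _).indicator (measurableSet_le measurable_const hu)
  refine hm.congr ?_
  filter_upwards [hΦ.ae_mono, hΦ.lsc, hΦ.map_zero] with t hmono hlsc h0
  apply le_antisymm
  · refine iSup_le fun q => ?_
    by_cases hq : ENNReal.ofReal q ≤ ‖u t‖ₑ
    · rw [Set.indicator_of_mem (by exact hq)]; exact hmono hq
    · rw [Set.indicator_of_notMem (by exact hq)]; exact zero_le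
  · refine le_of_forall_lt fun c hc => ?_
    have hpos : (0 : ℝ≥0∞) < ‖u t‖ₑ := by
      rw [pos_iff_ne_zero]
      intro h
      rw [h, h0] at hc
      exact not_lt_zero hc
    have hev : ∀ᶠ y in 𝓝[<] ‖u t‖ₑ, c < Φ t y := (hlsc _ c hc).filter_mono nhdsWithin_le_nhds
    obtain ⟨l, hl, hsub⟩ := (mem_nhdsLT_iff_exists_Ioo_subset' hpos).1 hev
    obtain ⟨q, -, hq1, hq2⟩ := ENNReal.lt_iff_exists_rat_btwn.1 hl
    have hcq : c < Φ t (ENNReal.ofReal q) := hsub ⟨hq1, hq2⟩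
    refine lt_iSup_iff.2 ⟨q, ?_⟩
    rw [Set.indicator_of_mem]
    · exact hcq
    · exact le_of_lt hq2

theorem modular_mono (hΦ : IsMusielakOrlicz μ Φ) {u v : T →ₘ[μ] ℝ}
    (h : ∀ᵐ t ∂μ, ‖u t‖ₑ ≤ ‖v t‖ₑ) : modular Φ u ≤ modular Φ v := by
  refine lintegral_mono_ae ?_
  filter_upwards [hΦ.ae_mono, h] with t ht h1
  exact ht h1

theorem modular_smul_mono (hΦ : IsMusielakOrlicz μ Φ) (u : T →ₘ[μ] ℝ) {r s : ℝ}
    (h : |r| ≤ |s|) : modular Φ (r • u) ≤ modular Φ (s • u) := by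
  refine modular_mono hΦ ?_
  filter_upwards [AEEqFun.coeFn_smul r u, AEEqFun.coeFn_smul s u] with t h1 h2
  rw [h1, h2, Pi.smul_apply, Pi.smul_apply, enorm_smul, enorm_smul]
  gcongr
  simpa [enorm_le_iff_norm_le] using h

theorem modular_half_add (hΦ : IsMusielakOrlicz μ Φ) (u v : T →ₘ[μ] ℝ) :
    modular Φ ((1 / 2 : ℝ) • (u + v)) ≤ modular Φ u + modular Φ v := by
  rw [modular, modular, modular, ← lintegral_add_left' (hΦ.aemeasurable_comp u)]
  refine lintegral_mono_ae ?_
  filter_upwards [hΦ.ae_mono, AEEqFun.coeFn_smul (1 / 2 : ℝ) (u + v), AEEqFun.coeFn_add u v]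
    with t hm h1 h2
  rw [h1, Pi.smul_apply, h2, Pi.add_apply]
  have hle : ‖(1 / 2 : ℝ) • (u t + v t)‖ₑ ≤ max ‖u t‖ₑ ‖v t‖ₑ := by
    rw [le_max_iff, enorm_le_iff_norm_le, enorm_le_iff_norm_le]
    simp only [smul_eq_mul, Real.norm_eq_abs, abs_mul]
    rw [abs_of_pos (by norm_num : (0 : ℝ) < 1 / 2)]
    have := abs_add_le (u t) (v t)
    rcases le_total |u t| |v t| with h | h
    · right; linarith
    · left; linarith
  refine (hm hle).trans ?_
  rcases le_total ‖u t‖ₑ ‖v t‖ₑ with h | h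
  · rw [max_eq_right h]; exact le_add_self
  · rw [max_eq_left h]; exact le_self_add

/-- The Musielak–Orlicz space `L^Φ = {u ∈ L⁰ : I_Φ(r u) < ∞ for some r > 0}`, as a vector subspace
of `L⁰`. -/
def moSpace (hΦ : IsMusielakOrlicz μ Φ) : Submodule ℝ (T →ₘ[μ] ℝ) where
  carrier := {u | ∃ r : ℝ, 0 < r ∧ modular Φ (r • u) < ∞}
  zero_mem' := by
    refine ⟨1, one_pos, ?_⟩
    have : modular Φ ((1 : ℝ) • (0 : T →ₘ[μ] ℝ)) = 0 := by
      rw [smul_zero, modular]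
      refine (lintegral_congr_ae ?_).trans lintegral_zero
      filter_upwards [hΦ.map_zero, AEEqFun.coeFn_zero (α := T) (β := ℝ) (μ := μ)] with t h1 h2
      rw [h2]
      simpa using h1
    rw [this]
    exact ENNReal.zero_lt_top
  add_mem' := by
    rintro u v ⟨r, hr, hu⟩ ⟨s, hs, hv⟩
    have hm : 0 < min r s := lt_min hr hs
    refine ⟨1 / 2 * min r s, by positivity, ?_⟩
    rw [mul_smul, smul_add]
    refine (modular_half_add hΦ _ _).trans_lt (ENNReal.add_lt_top.2 ⟨?_, ?_⟩)
    · refine (modular_smul_mono hΦ u ?_).trans_lt hu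
      rw [abs_of_pos hm, abs_of_pos hr]; exact min_le_left _ _
    · refine (modular_smul_mono hΦ v ?_).trans_lt hv
      rw [abs_of_pos hm, abs_of_pos hs]; exact min_le_right _ _
  smul_mem' := by
    rintro c u ⟨r, hr, hu⟩
    refine ⟨r / (|c| + 1), by positivity, ?_⟩
    rw [← mul_smul]
    refine (modular_smul_mono hΦ u ?_).trans_lt hu
    rw [abs_mul, abs_div, abs_of_pos hr, abs_of_pos (by positivity : (0 : ℝ) < |c| + 1),
      div_mul_eq_mul_div, div_le_iff₀ (by positivity)]
    nlinarith [abs_nonneg c]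

variable {hΦ : IsMusielakOrlicz μ Φ}

/-- The linear functional `f` belongs to the topological dual `(L^Φ)*`: it is bounded with respect
to the Luxemburg norm. -/
def InDual (f : moSpace hΦ →ₗ[ℝ] ℝ) : Prop :=
  ∃ C : ℝ≥0, ∀ u : moSpace hΦ, ‖f u‖ₑ ≤ C * luxNorm Φ (u : T →ₘ[μ] ℝ)

/-- `‖f‖₀ = sup |f(u)| / ‖u‖_Φ`, the norm dual to the Luxemburg norm. In `ℝ≥0∞` one has `0/0 = 0`
and `a/0 = ∞` for `a > 0`. -/
noncomputable def dualNormLux (f : moSpace hΦ →ₗ[ℝ] ℝ) : ℝ≥0∞ :=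
  ⨆ u : moSpace hΦ, ‖f u‖ₑ / luxNorm Φ (u : T →ₘ[μ] ℝ)

/-- `‖f‖ = sup |f(u)| / ‖u‖_{Φ,0}`, the norm dual to the Orlicz norm. -/
noncomputable def dualNormOrlicz (f : moSpace hΦ →ₗ[ℝ] ℝ) : ℝ≥0∞ :=
  ⨆ u : moSpace hΦ, ‖f u‖ₑ / orliczNorm Φ (u : T →ₘ[μ] ℝ)

/-- The positive part `f⁺(u) = sup {f(w) : 0 ≤ w ≤ u}` of a functional `f` in `(L^Φ)*`, at a
non-negative `u`. (The set is bounded when `f` is.) The negative part is `(-f)⁺`. -/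
noncomputable def posPart (f : moSpace hΦ →ₗ[ℝ] ℝ) (u : moSpace hΦ) : ℝ :=
  sSup (f '' Set.Icc 0 u)

/-- The order continuous component
`g_c(u) = inf {sup_n g(u_n) : 0 ≤ u_n ↑ u}` of a positive functional `g`, at a non-negative `u`. -/
noncomputable def ocPos (g : moSpace hΦ → ℝ) (u : moSpace hΦ) : ℝ :=
  sInf {x | ∃ w : ℕ → moSpace hΦ, (∀ n, 0 ≤ w n) ∧
    IncreasesTo (fun n => (w n : T →ₘ[μ] ℝ)) (u : T →ₘ[μ] ℝ) ∧ x = ⨆ n, g (w n)}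

/-- The order continuous component `f_c = (f⁺)_c - (f⁻)_c` of a functional `f` in `(L^Φ)*`, at a
non-negative `u`; a functional is determined by its values there. -/
noncomputable def ocComponent (f : moSpace hΦ →ₗ[ℝ] ℝ) (u : moSpace hΦ) : ℝ :=
  ocPos (posPart f) u - ocPos (posPart (-f)) u

/-- `f ∈ (L^Φ)*` is purely singular: its order continuous component vanishes. -/
def IsPurelySingular (f : moSpace hΦ →ₗ[ℝ] ℝ) : Prop :=
  InDual f ∧ ∀ u : moSpace hΦ, 0 ≤ u → ocComponent f u = 0

end Space

end MusielakOrlicz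

/-! A purely singular functional sees only the tails of a function. Vanishing of the order
continuous component gives, for each u and ε, functions 0 ≤ a n ↑ |u| on which both f⁺ and f⁻ are at
most ε (`IsPurelySingular.exists_increasesTo`). Clamping u to [-a n, a n] then changes f(u) into f(z
n) up to an error of order ε, with |z n| = |u| - a n ↓ 0 (`IsPurelySingular.exists_tail`).

For a monotone norm N, |f(u)| is therefore controlled by inf N(z n), which Q(u) dominates; this
gives the two formulas with Q. If moreover I_Φ(u) < ∞, dominated convergence gives I_Φ(z n) → 0, so
a norm N ≤ I_Φ + 1 has limsup N(z n) ≤ 1 and |f(u)| is at most the dual norm of f.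

The remaining equalities close a cycle: dual norm ≤ sup |f|/θ because θ is below both norms, sup
|f|/θ ≤ sup of |f| over finite modulars by homogeneity, and this is ≤ either dual norm by the
previous paragraph. Both norms must lie between θ and I_Φ + 1, which follows from θ ≤ Luxemburg ≤
Orlicz ≤ I_Φ + 1. The middle inequality, `luxNorm_le_orliczNorm`, is the only deep one: it rests on
the biconjugate formula for Φ and a measurable choice of near-maximizers. -/

namespace MusielakOrlicz

/-! ### Convex conjugates on the half-line -/

section Conjugate

theorem ConvexOn.chord_le {g : ℝ≥0∞ → ℝ≥0∞} (hc : ConvexOn ℝ≥0 Set.univ g)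
    {p q r P Q R : ℝ≥0} (hpq : p < q) (hqr : q < r) (hP : g p = P) (hQ : g q = Q) (hR : g r = R) :
    (Q : ℝ) * (r - p) ≤ P * (r - q) + R * (q - p) := by
  have hpr : p < r := hpq.trans hqr
  have hpr' : (0 : ℝ) < r - p := sub_pos.2 (by exact_mod_cast hpr)
  have hne : r - p ≠ 0 := (tsub_pos_of_lt hpr).ne'
  have hsum : (r - q) / (r - p) + (q - p) / (r - p) = 1 := by
    rw [← add_div, tsub_add_tsub_cancel hqr.le hpq.le, div_self hne]
  have key := hc.2 (Set.mem_univ (p : ℝ≥0∞)) (Set.mem_univ (r : ℝ≥0∞))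
    (zero_le : 0 ≤ (r - q) / (r - p)) (zero_le : 0 ≤ (q - p) / (r - p)) hsum
  have e : ((r - q) / (r - p)) * p + ((q - p) / (r - p)) * r = q := by
    rw [← NNReal.coe_inj]
    push_cast [NNReal.coe_sub hqr.le, NNReal.coe_sub hpq.le, NNReal.coe_sub hpr.le]
    field_simp
    ring
  simp only [ENNReal.smul_def, smul_eq_mul] at key
  rw [← ENNReal.coe_mul, ← ENNReal.coe_mul, ← ENNReal.coe_add, e, hP, hQ, hR] at key
  have key' : Q ≤ ((r - q) / (r - p)) * P + ((q - p) / (r - p)) * R := by exact_mod_cast key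
  rw [← NNReal.coe_le_coe] at key'
  push_cast [NNReal.coe_sub hqr.le, NNReal.coe_sub hpq.le, NNReal.coe_sub hpr.le] at key'
  have e2 : ((r : ℝ) - q) / (r - p) * P + (q - p) / (r - p) * R
      = (P * (r - q) + R * (q - p)) / (r - p) := by
    field_simp
  rwa [e2, le_div_iff₀ hpr'] at key'

/-- The line has the slope v of the chord over [x, y], lowered to height c at y. Using a chord
instead of a tangent avoids the edge of the domain of finiteness, where a subgradient may not exist.
-/
theorem exists_supporting_line {g : ℝ≥0∞ → ℝ≥0∞} (hc : ConvexOn ℝ≥0 Set.univ g)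
    (hm : Monotone g) {x y c : ℝ≥0} (hxy : x < y) (hcx : (c : ℝ≥0∞) ≤ g x) :
    ∃ v : ℝ≥0, ∀ u : ℝ≥0, (u : ℝ≥0∞) * v + c ≤ g u + y * v := by
  have hyx : y - x ≠ 0 := (tsub_pos_of_lt hxy).ne'
  rcases eq_or_ne (g y) ∞ with hy | hy
  -- With this slope the line through (y, c) vanishes at x, so it is nonpositive to the left of x;
  -- it is at most c on [x, y], and g = ∞ from y on.
  · refine ⟨c / (y - x), fun u => ?_⟩
    rcases lt_or_ge u x with hux | hux
    · refine le_trans ?_ le_add_self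
      norm_cast
      calc u * (c / (y - x)) + c ≤ x * (c / (y - x)) + (y - x) * (c / (y - x)) := by
            rw [mul_div_cancel₀ _ hyx]; gcongr
        _ = y * (c / (y - x)) := by rw [← add_mul, add_tsub_cancel_of_le hxy.le]
    rcases lt_or_ge u y with huy | huy
    · rw [add_comm]
      have h1 : (c : ℝ≥0∞) ≤ g u := hcx.trans (hm (by exact_mod_cast hux))
      have h2 : (u : ℝ≥0∞) ≤ y := by exact_mod_cast huy.le
      gcongr
    · have : g u = ∞ := top_le_iff.1 (hy ▸ hm (by exact_mod_cast huy))
      simp [this]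
  · have hx : g x ≠ ∞ := ne_top_of_le_ne_top hy (hm (by exact_mod_cast hxy.le))
    obtain ⟨b, hb⟩ : ∃ r : ℝ≥0, (r : ℝ≥0∞) = g y := ⟨_, ENNReal.coe_toNNReal hy⟩
    obtain ⟨a, ha⟩ : ∃ r : ℝ≥0, (r : ℝ≥0∞) = g x := ⟨_, ENNReal.coe_toNNReal hx⟩
    have hab : a ≤ b := by
      have := hm (show (x : ℝ≥0∞) ≤ y by exact_mod_cast hxy.le)
      rw [← ha, ← hb] at this; exact_mod_cast this
    have hca : c ≤ a := by rw [← ha] at hcx; exact_mod_cast hcx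
    refine ⟨(b - a) / (y - x), fun u => ?_⟩
    rcases eq_or_ne (g u) ∞ with hu | hu
    · simp [hu]
    obtain ⟨w, hw⟩ : ∃ r : ℝ≥0, (r : ℝ≥0∞) = g u := ⟨_, ENNReal.coe_toNNReal hu⟩
    rw [← hw]
    norm_cast
    rw [← NNReal.coe_le_coe]
    push_cast [NNReal.coe_sub hab, NNReal.coe_sub hxy.le]
    have hd : (0 : ℝ) < y - x := sub_pos.2 (by exact_mod_cast hxy)
    have hab' : (a : ℝ) ≤ b := by exact_mod_cast hab
    have hca' : (c : ℝ) ≤ a := by exact_mod_cast hca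
    have hmain : ((u : ℝ) - y) * (b - a) ≤ (w - a) * (y - x) := by
      rcases lt_or_ge u x with hux | hux
      · have := ConvexOn.chord_le hc hux hxy hw.symm ha.symm hb.symm
        nlinarith [mul_nonneg (sub_nonneg.2 hab') hd.le]
      rcases lt_or_ge y u with huy | huy
      · have := ConvexOn.chord_le hc hxy huy ha.symm hb.symm hw.symm
        nlinarith [mul_nonneg (sub_nonneg.2 hab') hd.le]
      · have h1 : a ≤ w := by
          have := hm (show (x : ℝ≥0∞) ≤ u by exact_mod_cast hux)
          rw [← ha, ← hw] at this; exact_mod_cast this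
        have h1' : (a : ℝ) ≤ w := by exact_mod_cast h1
        have h2 : (u : ℝ) ≤ y := by exact_mod_cast huy
        nlinarith [mul_nonneg (sub_nonneg.2 hab') (sub_nonneg.2 h2),
          mul_nonneg (sub_nonneg.2 h1') hd.le]
    have : ((u : ℝ) - y) * ((b - a) / (y - x)) ≤ w - a := by
      rw [← mul_div_assoc, div_le_iff₀ hd]; exact hmain
    linarith

variable {T : Type*} {Φ : T → ℝ≥0∞ → ℝ≥0∞}

theorem compl_mono (t : T) : Monotone (compl Φ t) := fun _ _ h =>
  iSup₂_mono fun _ _ => tsub_le_tsub_right (by gcongr) _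

theorem compl_zero (t : T) : compl Φ t 0 = 0 := by simp [compl]

theorem compl_mul_le (t : T) {a : ℝ≥0} (ha : a ≤ 1) (v : ℝ≥0∞) :
    compl Φ t (a * v) ≤ a * compl Φ t v := by
  refine iSup₂_le fun u hu => ?_
  calc (u : ℝ≥0∞) * (a * v) - Φ t u ≤ a * (u * v) - a * Φ t u := by
        rw [mul_left_comm]
        refine tsub_le_tsub_left ?_ _
        calc (a : ℝ≥0∞) * Φ t u ≤ 1 * Φ t u := by gcongr; exact_mod_cast ha
          _ = Φ t u := one_mul _
    _ = a * (u * v - Φ t u) := (ENNReal.mul_sub fun _ _ => ENNReal.coe_ne_top).symm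
    _ ≤ a * compl Φ t v := by
        gcongr
        exact le_iSup₂ (f := fun (u : ℝ≥0) (_ : 0 < u) => (u : ℝ≥0∞) * v - Φ t u) u hu

theorem mul_le_add_compl (t : T) (u : ℝ≥0) (v : ℝ≥0∞) :
    (u : ℝ≥0∞) * v ≤ Φ t u + compl Φ t v := by
  rcases eq_or_ne u 0 with rfl | hu
  · simp
  · rw [← tsub_le_iff_left]
    exact le_iSup₂ (f := fun (u : ℝ≥0) (_ : 0 < u) => (u : ℝ≥0∞) * v - Φ t u) u
      (pos_iff_ne_zero.2 hu)

/-- Moving u slightly to the left does not increase Φ and barely changes u v. A countable supremum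
makes Φ* measurable in t. -/
theorem compl_eq_iSup_of_dense {t : T} (hm : Monotone (Φ t)) {q : ℕ → ℝ≥0} (hq : DenseRange q)
    (v : ℝ≥0) : compl Φ t v = ⨆ i, ((q i : ℝ≥0∞) * v - Φ t (q i)) := by
  apply le_antisymm
  · refine iSup₂_le fun u hu => le_of_forall_lt fun c hcu => ?_
    have hcu' : c + Φ t u < u * v := lt_tsub_iff_right.1 hcu
    have hlim : Tendsto (fun r : ℝ≥0 => (r : ℝ≥0∞) * v) (𝓝[<] u) (𝓝 (u * v)) := by
      have : Continuous fun r : ℝ≥0 => ((r * v : ℝ≥0) : ℝ≥0∞) := by fun_prop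
      simpa using (this.tendsto u).mono_left nhdsWithin_le_nhds
    have hev := hlim.eventually (lt_mem_nhds hcu')
    obtain ⟨l, hl, hsub⟩ := (mem_nhdsLT_iff_exists_Ioo_subset' hu).1 hev
    obtain ⟨_, ⟨i, rfl⟩, h1, h2⟩ := Dense.exists_between hq hl
    refine lt_iSup_iff.2 ⟨i, lt_tsub_iff_right.2 (lt_of_le_of_lt ?_ (hsub ⟨h1, h2⟩))⟩
    gcongr
    exact hm (by exact_mod_cast h2.le)
  · exact iSup_le fun i => tsub_le_iff_left.2 (mul_le_add_compl t _ _)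

/-- Half of the biconjugate formula, with slack x < y. The slack is spent twice: on the supporting
line at z, and on replacing its slope v by a point of the dense sequence. -/
theorem le_iSup_mul_sub_compl {t : T} (hc : ConvexOn ℝ≥0 Set.univ (Φ t)) (h0 : Φ t 0 = 0)
    (hm : Monotone (Φ t))
    {q : ℕ → ℝ≥0} (hq : DenseRange q) {x y : ℝ≥0} (hxy : x < y) :
    Φ t x ≤ ⨆ i, ((y : ℝ≥0∞) * q i - compl Φ t (q i)) := by
  refine ENNReal.le_of_forall_nnreal_lt fun c hcx => ?_
  obtain ⟨z, hxz, hzy⟩ := exists_between hxy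
  obtain ⟨v, hv⟩ := exists_supporting_line hc hm hxz hcx.le
  have hcv : (c : ℝ≥0∞) + compl Φ t v ≤ z * v := by
    have hcz : (c : ℝ≥0∞) ≤ z * v := by simpa [h0] using hv 0
    have : compl Φ t v ≤ z * v - c := by
      refine iSup₂_le fun u _ => ?_
      rw [tsub_le_iff_left, ← ENNReal.add_le_add_iff_right (ENNReal.coe_ne_top (r := c)), add_assoc,
        tsub_add_cancel_of_le hcz]
      exact hv u
    calc (c : ℝ≥0∞) + compl Φ t v ≤ c + (z * v - c) := by gcongr
      _ = z * v := add_tsub_cancel_of_le hcz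
  rcases eq_or_ne v 0 with rfl | hv0
  · have : c = 0 := by simpa using le_self_add.trans hcv
    simp [this]
  have hy : 0 < y := lt_of_le_of_lt zero_le hxy
  -- Any q i in this gap satisfies y q i ≥ z v, while Φ*(q i) ≤ Φ*(v) by monotonicity.
  have hlt : z * v / y < v := by
    rw [div_lt_iff₀ hy, mul_comm]
    exact mul_lt_mul_of_pos_left hzy (pos_iff_ne_zero.2 hv0)
  obtain ⟨_, ⟨i, rfl⟩, h1, h2⟩ := Dense.exists_between hq hlt
  have h3 : (z : ℝ≥0∞) * v ≤ y * q i := by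
    rw [div_lt_iff₀ hy, mul_comm _ y] at h1
    exact_mod_cast h1.le
  have h4 : compl Φ t (q i) ≤ compl Φ t v := compl_mono t (by exact_mod_cast h2.le)
  refine le_iSup_of_le i (ENNReal.le_sub_of_add_le_right ?_ ?_)
  · refine ne_top_of_le_ne_top ?_ (h4.trans (le_add_self.trans hcv))
    exact ENNReal.mul_ne_top ENNReal.coe_ne_top ENNReal.coe_ne_top
  · exact (add_le_add_right h4 _).trans (hcv.trans h3)

end Conjugate

/-! ### Maximizing over finitely many indices -/

section Argmax

variable {T : Type*}

/-- The first index `i ≤ N` at which `val · t` attains its maximum over `{0, …, N}`. -/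
noncomputable def argmaxUpTo (val : ℕ → T → ℝ≥0∞) : ℕ → T → ℕ
  | 0, _ => 0
  | N + 1, t => if val (argmaxUpTo val N t) t < val (N + 1) t then N + 1 else argmaxUpTo val N t

theorem argmaxUpTo_le (val : ℕ → T → ℝ≥0∞) (N : ℕ) (t : T) : argmaxUpTo val N t ≤ N := by
  induction N with
  | zero => simp [argmaxUpTo]
  | succ N ih => rw [argmaxUpTo]; split_ifs <;> omega

theorem le_val_argmaxUpTo (val : ℕ → T → ℝ≥0∞) {N i : ℕ} (hi : i ≤ N) (t : T) :
    val i t ≤ val (argmaxUpTo val N t) t := by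
  induction N with
  | zero => rw [Nat.le_zero.1 hi, argmaxUpTo]
  | succ N ih =>
    rw [argmaxUpTo]
    rcases Nat.lt_or_ge N i with h | h
    · obtain rfl : i = N + 1 := by omega
      split_ifs with h1
      · exact le_rfl
      · exact not_lt.1 h1
    · split_ifs with h1
      · exact (ih h).trans h1.le
      · exact ih h

/-- For values that are truncated differences, a positive maximum is a genuine difference; index 0
will carry the slope 0. -/
theorem argmaxUpTo_eq_zero_or (val : ℕ → T → ℝ≥0∞) (N : ℕ) (t : T) :
    argmaxUpTo val N t = 0 ∨ 0 < val (argmaxUpTo val N t) t := by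
  induction N with
  | zero => left; rfl
  | succ N ih =>
    rw [argmaxUpTo]
    split_ifs with h1
    · right; exact lt_of_le_of_lt zero_le h1
    · exact ih

end Argmax

/-! ### Luxemburg and Orlicz norms -/

section Norms

variable {T : Type*} [MeasurableSpace T] {μ : Measure T} {Φ : T → ℝ≥0∞ → ℝ≥0∞}

theorem ae_enorm_smul (r : ℝ) (u : T →ₘ[μ] ℝ) :
    ∀ᵐ t ∂μ, ‖(r • u) t‖ₑ = ‖r‖ₑ * ‖u t‖ₑ := by
  filter_upwards [AEEqFun.coeFn_smul r u] with t h
  rw [h, Pi.smul_apply, enorm_smul]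

theorem mem_moSpace_of_enorm_le (hΦ : IsMusielakOrlicz μ Φ) {u v : T →ₘ[μ] ℝ}
    (hv : v ∈ moSpace hΦ) (h : ∀ᵐ t ∂μ, ‖u t‖ₑ ≤ ‖v t‖ₑ) : u ∈ moSpace hΦ := by
  obtain ⟨r, hr, hlt⟩ := hv
  refine ⟨r, hr, (modular_mono hΦ ?_).trans_lt hlt⟩
  filter_upwards [h, ae_enorm_smul r u, ae_enorm_smul r v] with t h1 h2 h3
  rw [h2, h3]
  gcongr

theorem modular_smul_le_mul (hΦ : IsMusielakOrlicz μ Φ) (u : T →ₘ[μ] ℝ) {a : ℝ≥0} (ha : a ≤ 1) :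
    modular Φ ((a : ℝ) • u) ≤ a * modular Φ u := by
  rw [modular, modular, ← lintegral_const_mul'' _ (hΦ.aemeasurable_comp u)]
  refine lintegral_mono_ae ?_
  filter_upwards [hΦ.convex, hΦ.map_zero, ae_enorm_smul (a : ℝ) u] with t hc h0 h
  have key := hc.2 (Set.mem_univ ‖u t‖ₑ) (Set.mem_univ (0 : ℝ≥0∞)) (zero_le : 0 ≤ a)
    (zero_le : 0 ≤ 1 - a) (add_tsub_cancel_of_le ha)
  rw [smul_zero, add_zero, h0, smul_zero, add_zero, ENNReal.smul_def, ENNReal.smul_def,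
    smul_eq_mul, smul_eq_mul] at key
  rw [h]
  simpa [enorm_eq_nnnorm] using key

theorem luxNorm_mono (hΦ : IsMusielakOrlicz μ Φ) {u v : T →ₘ[μ] ℝ}
    (h : ∀ᵐ t ∂μ, ‖u t‖ₑ ≤ ‖v t‖ₑ) : luxNorm Φ u ≤ luxNorm Φ v := by
  refine iInf₂_mono fun r hr => le_iInf fun hle => iInf_le_of_le ?_ le_rfl
  refine (modular_mono hΦ ?_).trans hle
  filter_upwards [h, ae_enorm_smul r⁻¹ u, ae_enorm_smul r⁻¹ v] with t h1 h2 h3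
  rw [h2, h3]
  gcongr

theorem luxNorm_le_ofReal {u : T →ₘ[μ] ℝ} {r : ℝ} (hr : 0 < r)
    (h : modular Φ (r⁻¹ • u) ≤ 1) : luxNorm Φ u ≤ ENNReal.ofReal r :=
  iInf_le_of_le r (iInf_le_of_le hr (iInf_le_of_le h le_rfl))

theorem theta_le_luxNorm (u : T →ₘ[μ] ℝ) : theta Φ u ≤ luxNorm Φ u :=
  iInf₂_mono fun _ _ => le_iInf fun hle =>
    iInf_le_of_le (hle.trans_lt ENNReal.one_lt_top) le_rfl

theorem luxNorm_ne_top (hΦ : IsMusielakOrlicz μ Φ) {u : T →ₘ[μ] ℝ} (hu : u ∈ moSpace hΦ) :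
    luxNorm Φ u ≠ ∞ := by
  obtain ⟨r, hr, hlt⟩ := hu
  set c : ℝ≥0 := (modular Φ (r • u)).toNNReal with hc
  have hcI : modular Φ (r • u) = c := (ENNReal.coe_toNNReal hlt.ne).symm
  set a : ℝ≥0 := (c + 1)⁻¹ with ha
  have ha0 : 0 < a := by positivity
  have ha1 : a ≤ 1 := inv_le_one_of_one_le₀ le_add_self
  have hpos : 0 < ((a : ℝ) * r)⁻¹ := by positivity
  refine ne_top_of_le_ne_top ENNReal.ofReal_ne_top (luxNorm_le_ofReal hpos ?_)
  rw [inv_inv, mul_smul]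
  refine (modular_smul_le_mul hΦ _ ha1).trans ?_
  rw [hcI]
  norm_cast
  rw [ha, inv_mul_le_iff₀ (by positivity), mul_one]
  exact le_self_add

theorem aemeasurable_compl (hΦ : IsMusielakOrlicz μ Φ) (v : ℝ≥0) :
    AEMeasurable (fun t => compl Φ t v) μ := by
  have : AEMeasurable (fun t => ⨆ i, ((TopologicalSpace.denseSeq ℝ≥0 i : ℝ≥0∞) * v
      - Φ t (TopologicalSpace.denseSeq ℝ≥0 i))) μ :=
    AEMeasurable.iSup fun i => aemeasurable_const.sub (hΦ.measurable _)
  refine this.congr ?_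
  filter_upwards [hΦ.ae_mono] with t hm
  exact (compl_eq_iSup_of_dense hm (TopologicalSpace.denseRange_denseSeq _) v).symm

theorem lintegral_enorm_mul_le (hΦ : IsMusielakOrlicz μ Φ) (u v : T →ₘ[μ] ℝ) :
    ∫⁻ t, ‖u t‖ₑ * ‖v t‖ₑ ∂μ ≤ modular Φ u + modular (compl Φ) v := by
  rw [modular, modular, ← lintegral_add_left' (hΦ.aemeasurable_comp u)]
  exact lintegral_mono fun t => mul_le_add_compl t ‖u t‖₊ ‖v t‖ₑ

theorem lintegral_enorm_mul_ne_top {hΦ : IsMusielakOrlicz μ Φ} {u v : T →ₘ[μ] ℝ}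
    (hu : u ∈ moSpace hΦ) (hv : modular (compl Φ) v ≠ ∞) :
    ∫⁻ t, ‖u t‖ₑ * ‖v t‖ₑ ∂μ ≠ ∞ := by
  obtain ⟨r, hr, hlt⟩ := hu
  have h := (lintegral_enorm_mul_le hΦ (r • u) v).trans_lt (ENNReal.add_lt_top.2 ⟨hlt, hv.lt_top⟩)
  have e : ∫⁻ t, ‖(r • u) t‖ₑ * ‖v t‖ₑ ∂μ = ‖r‖ₑ * ∫⁻ t, ‖u t‖ₑ * ‖v t‖ₑ ∂μ := by
    rw [← lintegral_const_mul' _ _ enorm_ne_top]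
    refine lintegral_congr_ae ?_
    filter_upwards [ae_enorm_smul r u] with t h1
    rw [h1, mul_assoc]
  rw [e] at h
  intro htop
  rw [htop, ENNReal.mul_top (by simpa using hr.ne')] at h
  exact lt_irrefl _ h

theorem lintegral_enorm_mul_le_orliczNorm {hΦ : IsMusielakOrlicz μ Φ} {u v : T →ₘ[μ] ℝ}
    (hu : u ∈ moSpace hΦ) (hv : modular (compl Φ) v ≤ 1) :
    ∫⁻ t, ‖u t‖ₑ * ‖v t‖ₑ ∂μ ≤ orliczNorm Φ u := by
  have hmeas : Measurable fun t => if 0 ≤ u t then |v t| else -|v t| :=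
    Measurable.ite (measurableSet_le measurable_const u.measurable) v.measurable.abs
      v.measurable.abs.neg
  -- Giving |v| the sign of u keeps the modular and turns the integral of the product into that of
  -- |u v|.
  set w : T →ₘ[μ] ℝ := AEEqFun.mk _ hmeas.aestronglyMeasurable with hw
  have hwt : ∀ᵐ t ∂μ, w t = if 0 ≤ u t then |v t| else -|v t| := AEEqFun.coeFn_mk _ _
  have hwv : ∀ᵐ t ∂μ, ‖w t‖ₑ = ‖v t‖ₑ := by
    filter_upwards [hwt] with t h
    rw [h]
    split_ifs <;> simp [enorm_eq_nnnorm]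
  have hmod : modular (compl Φ) w ≤ 1 := by
    refine le_trans (le_of_eq (lintegral_congr_ae ?_)) hv
    filter_upwards [hwv] with t h
    rw [h]
  have huw : ∀ᵐ t ∂μ, u t * w t = |u t * v t| := by
    filter_upwards [hwt] with t h
    rw [h, abs_mul]
    split_ifs with h0
    · rw [abs_of_nonneg h0]
    · rw [abs_of_neg (not_le.1 h0)]; ring
  refine le_trans (le_of_eq ?_) (le_iSup₂_of_le (f := fun (v : T →ₘ[μ] ℝ)
    (_ : modular (compl Φ) v ≤ 1) => ‖∫ t, u t * v t ∂μ‖ₑ) w hmod le_rfl)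
  have hfin := lintegral_enorm_mul_ne_top hu (ne_top_of_le_ne_top ENNReal.one_ne_top hv)
  have hint : Integrable (fun t => |u t * v t|) μ := by
    refine ⟨(u.measurable.mul v.measurable).abs.aestronglyMeasurable, ?_⟩
    rw [hasFiniteIntegral_iff_enorm]
    simpa [enorm_eq_nnnorm] using hfin.lt_top
  rw [integral_congr_ae huw, Real.enorm_of_nonneg (integral_nonneg fun _ => abs_nonneg _),
    ofReal_integral_eq_lintegral_ofReal hint (ae_of_all _ fun _ => abs_nonneg _)]
  refine lintegral_congr fun t => ?_
  rw [← enorm_mul, ← Real.enorm_of_nonneg (abs_nonneg _)]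
  simp [enorm_eq_nnnorm]

theorem orliczNorm_le {u : T →ₘ[μ] ℝ} {c : ℝ≥0∞}
    (h : ∀ v : T →ₘ[μ] ℝ, modular (compl Φ) v ≤ 1 → ∫⁻ t, ‖u t‖ₑ * ‖v t‖ₑ ∂μ ≤ c) :
    orliczNorm Φ u ≤ c := by
  refine iSup₂_le fun v hv => (enorm_integral_le_lintegral_enorm _).trans ?_
  simpa only [enorm_mul] using h v hv

theorem orliczNorm_mono {hΦ : IsMusielakOrlicz μ Φ} {w u : T →ₘ[μ] ℝ} (hu : u ∈ moSpace hΦ)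
    (h : ∀ᵐ t ∂μ, ‖w t‖ₑ ≤ ‖u t‖ₑ) : orliczNorm Φ w ≤ orliczNorm Φ u := by
  refine orliczNorm_le fun v hv => le_trans (lintegral_mono_ae ?_)
    (lintegral_enorm_mul_le_orliczNorm hu hv)
  filter_upwards [h] with t h
  gcongr

theorem orliczNorm_le_modular_add_one (hΦ : IsMusielakOrlicz μ Φ) (u : T →ₘ[μ] ℝ) :
    orliczNorm Φ u ≤ modular Φ u + 1 :=
  orliczNorm_le fun v hv => (lintegral_enorm_mul_le hΦ u v).trans (by gcongr)

theorem orliczNorm_smul (r : ℝ) (u : T →ₘ[μ] ℝ) :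
    orliczNorm Φ (r • u) = ‖r‖ₑ * orliczNorm Φ u := by
  simp only [orliczNorm, ENNReal.mul_iSup]
  refine iSup_congr fun v => iSup_congr fun _ => ?_
  rw [← enorm_mul, ← integral_const_mul]
  congr 1
  refine integral_congr_ae ?_
  filter_upwards [AEEqFun.coeFn_smul r u] with t h
  rw [h, Pi.smul_apply, smul_eq_mul, mul_assoc]

theorem orliczNorm_ne_top {hΦ : IsMusielakOrlicz μ Φ} {u : T →ₘ[μ] ℝ} (hu : u ∈ moSpace hΦ) :
    orliczNorm Φ u ≠ ∞ := by
  obtain ⟨r, hr, hlt⟩ := hu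
  have h : orliczNorm Φ (r • u) < ∞ := (orliczNorm_le_modular_add_one hΦ _).trans_lt
    (ENNReal.add_lt_top.2 ⟨hlt, ENNReal.one_lt_top⟩)
  rw [orliczNorm_smul] at h
  intro htop
  rw [htop, ENNReal.mul_top (by simpa using hr.ne')] at h
  exact lt_irrefl _ h

theorem modular_compl_smul_le {a : ℝ≥0} (ha : a ≤ 1) (v : T →ₘ[μ] ℝ) :
    modular (compl Φ) ((a : ℝ) • v) ≤ a * modular (compl Φ) v := by
  rw [modular, modular, ← lintegral_const_mul' _ _ ENNReal.coe_ne_top]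
  refine lintegral_mono_ae ?_
  filter_upwards [ae_enorm_smul (a : ℝ) v] with t h
  rw [h]
  simpa [enorm_eq_nnnorm] using compl_mul_le (Φ := Φ) t ha ‖v t‖ₑ

/-- If c = I_{Φ*}(v) exceeds 1, then v / c has modular at most 1 by convexity and `Φ*(t, 0) = 0`, so
it is admissible for the Orlicz norm. -/
theorem lintegral_enorm_mul_le_max {hΦ : IsMusielakOrlicz μ Φ} {u v : T →ₘ[μ] ℝ}
    (hu : u ∈ moSpace hΦ) (hu1 : orliczNorm Φ u ≤ 1) (hv : modular (compl Φ) v ≠ ∞) :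
    ∫⁻ t, ‖u t‖ₑ * ‖v t‖ₑ ∂μ ≤ max 1 (modular (compl Φ) v) := by
  rcases le_total (modular (compl Φ) v) 1 with h | h
  · exact ((lintegral_enorm_mul_le_orliczNorm hu h).trans hu1).trans (le_max_left _ _)
  refine le_trans ?_ (le_max_right _ _)
  obtain ⟨c, hc⟩ : ∃ c : ℝ≥0, (c : ℝ≥0∞) = modular (compl Φ) v := ⟨_, ENNReal.coe_toNNReal hv⟩
  rw [← hc] at h ⊢
  have hc1 : 1 ≤ c := by exact_mod_cast h
  have hc0 : c ≠ 0 := (one_pos.trans_le hc1).ne'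
  have hmod : modular (compl Φ) (((c⁻¹ : ℝ≥0) : ℝ) • v) ≤ 1 := by
    refine (modular_compl_smul_le (inv_le_one_of_one_le₀ hc1) v).trans ?_
    rw [← hc, ← ENNReal.coe_mul, inv_mul_cancel₀ hc0, ENNReal.coe_one]
  have key := (lintegral_enorm_mul_le_orliczNorm hu hmod).trans hu1
  have e : ∫⁻ t, ‖u t‖ₑ * ‖(((c⁻¹ : ℝ≥0) : ℝ) • v) t‖ₑ ∂μ
      = ((c⁻¹ : ℝ≥0) : ℝ≥0∞) * ∫⁻ t, ‖u t‖ₑ * ‖v t‖ₑ ∂μ := by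
    rw [← lintegral_const_mul' _ _ ENNReal.coe_ne_top]
    refine lintegral_congr_ae ?_
    filter_upwards [ae_enorm_smul ((c⁻¹ : ℝ≥0) : ℝ) v] with t h1
    have h2 : ‖((c⁻¹ : ℝ≥0) : ℝ)‖ₑ = ((c⁻¹ : ℝ≥0) : ℝ≥0∞) := by simp [enorm_eq_nnnorm]
    rw [h1, h2, mul_left_comm]
  rw [e] at key
  calc ∫⁻ t, ‖u t‖ₑ * ‖v t‖ₑ ∂μ
      = c * (((c⁻¹ : ℝ≥0) : ℝ≥0∞) * ∫⁻ t, ‖u t‖ₑ * ‖v t‖ₑ ∂μ) := by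
        rw [← mul_assoc, ← ENNReal.coe_mul, mul_inv_cancel₀ hc0, ENNReal.coe_one, one_mul]
    _ ≤ c * 1 := by gcongr
    _ = c := mul_one _

theorem measurable_val_index {val : ℕ → T → ℝ≥0∞} (hval : ∀ i, Measurable (val i)) {k : T → ℕ}
    (hk : Measurable k) : Measurable fun t => val (k t) t := by
  have : Measurable fun p : T × ℕ => val p.2 p.1 :=
    measurable_from_prod_countable_left fun i => hval i
  exact this.comp (measurable_id.prodMk hk)

theorem measurable_argmaxUpTo {val : ℕ → T → ℝ≥0∞} (hval : ∀ i, Measurable (val i)) (N : ℕ) :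
    Measurable (argmaxUpTo val N) := by
  induction N with
  | zero => exact measurable_const
  | succ N ih =>
    exact Measurable.ite (measurableSet_lt (measurable_val_index hval ih) (hval _))
      measurable_const ih

theorem exists_denseRange_zero : ∃ q : ℕ → ℝ≥0, q 0 = 0 ∧ DenseRange q := by
  refine ⟨fun n => Nat.casesOn n 0 (TopologicalSpace.denseSeq ℝ≥0), rfl, ?_⟩
  refine Dense.mono ?_ (TopologicalSpace.denseRange_denseSeq ℝ≥0)
  rintro _ ⟨n, rfl⟩
  exact ⟨n + 1, rfl⟩

/-- Measurable near-maximizers in `Φ(t,u) = sup_v (u v - Φ*(t,v))`. -/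
theorem exists_conjugate_selection [SigmaFinite μ] (hΦ : IsMusielakOrlicz μ Φ) (u : T →ₘ[μ] ℝ) :
    ∃ (H : ℕ → T → ℝ≥0∞) (v : ℕ → T →ₘ[μ] ℝ), (∀ N, Measurable (H N)) ∧ Monotone H ∧
      (∀ s : ℝ≥0, s < 1 → ∀ᵐ t ∂μ, Φ t ‖((s : ℝ) • u) t‖ₑ ≤ ⨆ N, H N t) ∧
      (∀ N, ∀ᵐ t ∂μ, H N t + compl Φ t ‖v N t‖ₑ ≤ ‖u t‖ₑ * ‖v N t‖ₑ) ∧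
      ∀ N, ∫⁻ t, ‖u t‖ₑ * ‖v N t‖ₑ ∂μ < ∞ := by
  obtain ⟨q, hq0, hq⟩ := exists_denseRange_zero
  obtain ⟨G, hGm, hG⟩ : ∃ G : ℕ → T → ℝ≥0∞, (∀ i, Measurable (G i)) ∧
      ∀ᵐ t ∂μ, ∀ i, compl Φ t (q i) = G i t :=
    ⟨fun i => (aemeasurable_compl hΦ (q i)).mk, fun i => (aemeasurable_compl hΦ _).measurable_mk,
      ae_all_iff.2 fun i => (aemeasurable_compl hΦ (q i)).ae_eq_mk⟩
  let U : T → ℝ≥0 := fun t => ‖u t‖₊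
  have hU : Measurable U := u.measurable.nnnorm
  let val : ℕ → T → ℝ≥0∞ := fun i t => (U t : ℝ≥0∞) * q i - G i t
  have hval : ∀ i, Measurable (val i) := fun i =>
    (hU.coe_nnreal_ennreal.mul_const _).sub (hGm i)
  let k := argmaxUpTo val
  have hk : ∀ N, Measurable (k N) := measurable_argmaxUpTo hval
  -- On B N the function u is bounded and the measure finite, which makes the integral of |u v N|
  -- finite.
  let B : ℕ → Set T := fun N => {t | U t ≤ N} ∩ spanningSets μ N
  have hB : ∀ N, MeasurableSet (B N) := fun N =>
    (measurableSet_le hU measurable_const).inter (measurableSet_spanningSets μ N)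
  let H : ℕ → T → ℝ≥0∞ := fun N => (B N).indicator fun t => val (k N t) t
  have hH : ∀ N, Measurable (H N) := fun N => (measurable_val_index hval (hk N)).indicator (hB N)
  have hHmono : Monotone H := by
    intro N M hNM t
    by_cases ht : t ∈ B N
    · have htM : t ∈ B M :=
        ⟨show U t ≤ M from (show U t ≤ N from ht.1).trans (by exact_mod_cast hNM),
          monotone_spanningSets μ hNM ht.2⟩
      simp only [H, Set.indicator_of_mem ht, Set.indicator_of_mem htM]
      exact le_val_argmaxUpTo val ((argmaxUpTo_le val N t).trans hNM) t
    · simp only [H, Set.indicator_of_notMem ht]; exact zero_le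
  have hle : ∀ s : ℝ≥0, s < 1 → ∀ᵐ t ∂μ, Φ t ‖((s : ℝ) • u) t‖ₑ ≤ ⨆ N, H N t := by
    intro s hs
    filter_upwards [hΦ.convex, hΦ.map_zero, hΦ.ae_mono, hG, ae_enorm_smul (s : ℝ) u]
      with t hc h0 hm hGt hst
    have e : ‖((s : ℝ) • u) t‖ₑ = ((s * U t : ℝ≥0) : ℝ≥0∞) := by
      rw [hst]; simp [enorm_eq_nnnorm, U]
    rw [e]
    rcases eq_or_ne (U t) 0 with h | h
    · simp [h, h0]
    have hlt : s * U t < U t := by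
      simpa using mul_lt_mul_of_pos_right hs (pos_iff_ne_zero.2 h)
    refine (le_iSup_mul_sub_compl hc h0 hm hq hlt).trans (iSup_le fun i => ?_)
    rw [hGt]
    obtain ⟨n1, hn1⟩ := exists_nat_ge (U t)
    have hn2 : t ∈ ⋃ n, spanningSets μ n := by rw [iUnion_spanningSets]; trivial
    obtain ⟨n2, hn2⟩ := Set.mem_iUnion.1 hn2
    let N := max i (max n1 n2)
    have htB : t ∈ B N := by
      refine ⟨hn1.trans ?_, monotone_spanningSets μ ?_ hn2⟩
      · exact_mod_cast (le_max_left n1 n2).trans (le_max_right _ _)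
      · exact (le_max_right n1 n2).trans (le_max_right _ _)
    refine le_iSup_of_le N ?_
    simp only [H, Set.indicator_of_mem htB]
    exact le_val_argmaxUpTo val (le_max_left _ _) t
  let V : ℕ → T → ℝ≥0 := fun N => (B N).indicator fun t => q (k N t)
  have hV : ∀ N, Measurable (V N) := fun N =>
    ((measurable_from_nat (f := q)).comp (hk N)).indicator (hB N)
  let v : ℕ → T →ₘ[μ] ℝ := fun N => AEEqFun.mk (fun t => (V N t : ℝ))
    (hV N).coe_nnreal_real.aestronglyMeasurable
  have hv : ∀ N, ∀ᵐ t ∂μ, ‖v N t‖ₑ = V N t := by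
    intro N
    filter_upwards [AEEqFun.coeFn_mk (μ := μ) (fun t => (V N t : ℝ))
      (hV N).coe_nnreal_real.aestronglyMeasurable] with t h
    rw [h]; simp [enorm_eq_nnnorm]
  refine ⟨H, v, hH, hHmono, hle, fun N => ?_, fun N => ?_⟩
  · filter_upwards [hG, hv N] with t hGt hvt
    rw [hvt]
    by_cases ht : t ∈ B N
    · simp only [H, V, Set.indicator_of_mem ht]
      rcases argmaxUpTo_eq_zero_or val N t with h | h
      · simp [k, h, val, hq0, compl_zero]
      · have h' : G (k N t) t < U t * q (k N t) := tsub_pos_iff_lt.1 h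
        rw [hGt]
        exact (tsub_add_cancel_of_le h'.le).le
    · simp [H, V, Set.indicator_of_notMem ht, compl_zero]
  · let K : ℝ≥0 := (Finset.range (N + 1)).sup q
    have hb : ∫⁻ t, ‖u t‖ₑ * ‖v N t‖ₑ ∂μ ≤ ∫⁻ t, (B N).indicator (fun _ => ((N * K : ℝ≥0) : ℝ≥0∞)) t
        ∂μ := by
      refine lintegral_mono_ae ?_
      filter_upwards [hv N] with t hvt
      rw [hvt]
      by_cases ht : t ∈ B N
      · have h1 : q (k N t) ≤ K :=
          Finset.le_sup (f := q) (Finset.mem_range_succ_iff.2 (argmaxUpTo_le val N t))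
        have h2 : U t ≤ N := ht.1
        simp only [V, Set.indicator_of_mem ht]
        calc ‖u t‖ₑ * (q (k N t) : ℝ≥0∞) = ((U t * q (k N t) : ℝ≥0) : ℝ≥0∞) := by
              simp [U, enorm_eq_nnnorm]
          _ ≤ _ := by exact_mod_cast mul_le_mul' h2 h1
      · simp [V, Set.indicator_of_notMem ht]
    refine hb.trans_lt ?_
    rw [lintegral_indicator_const (hB N)]
    exact ENNReal.mul_lt_top ENNReal.coe_lt_top
      ((measure_mono Set.inter_subset_right).trans_lt (measure_spanningSets_lt_top μ N))

/-- Near-maximizers give ∫ H N + I_{Φ*}(v N) ≤ max(1, I_{Φ*}(v N)). Finiteness of I_{Φ*}(v N) allows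
cancellation, so ∫ H N ≤ 1 in either case, and monotone convergence finishes. -/
theorem modular_smul_le_one [SigmaFinite μ] {hΦ : IsMusielakOrlicz μ Φ} {u : T →ₘ[μ] ℝ}
    (hu : u ∈ moSpace hΦ) (hu1 : orliczNorm Φ u ≤ 1) {s : ℝ≥0} (hs : s < 1) :
    modular Φ ((s : ℝ) • u) ≤ 1 := by
  obtain ⟨H, v, hH, hHmono, hle, hpt, hfin⟩ := exists_conjugate_selection hΦ u
  refine (lintegral_mono_ae (hle s hs)).trans ?_
  rw [lintegral_iSup hH hHmono]
  refine iSup_le fun N => ?_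
  -- Superadditivity of the lower integral suffices, so Φ*(t, |v N t|) need not be shown measurable.
  have hsum : ∫⁻ t, H N t ∂μ + modular (compl Φ) (v N) ≤ ∫⁻ t, ‖u t‖ₑ * ‖v N t‖ₑ ∂μ :=
    (le_lintegral_add _ _).trans (lintegral_mono_ae (hpt N))
  have hvfin : modular (compl Φ) (v N) ≠ ∞ := (le_add_self.trans_lt (hsum.trans_lt (hfin N))).ne
  have hmax := hsum.trans (lintegral_enorm_mul_le_max hu hu1 hvfin)
  rcases le_total (modular (compl Φ) (v N)) 1 with h | h
  · rw [max_eq_left h] at hmax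
    exact le_self_add.trans hmax
  · rw [max_eq_right h] at hmax
    refine le_trans ?_ zero_le_one
    refine (ENNReal.add_le_add_iff_right hvfin).1 ?_
    rwa [zero_add]

theorem luxNorm_le_orliczNorm [SigmaFinite μ] {hΦ : IsMusielakOrlicz μ Φ} {u : T →ₘ[μ] ℝ}
    (hu : u ∈ moSpace hΦ) : luxNorm Φ u ≤ orliczNorm Φ u := by
  refine ENNReal.le_of_forall_pos_le_add fun ε hε hlt => ?_
  obtain ⟨a, ha⟩ : ∃ a : ℝ≥0, (a : ℝ≥0∞) = orliczNorm Φ u := ⟨_, ENNReal.coe_toNNReal hlt.ne⟩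
  rw [← ha]
  -- u / b has Orlicz norm at most 1, and b / c is the factor s < 1 that takes it to u / c.
  set b : ℝ≥0 := a + ε / 2 with hb
  set c : ℝ≥0 := a + ε with hcdef
  have hb0 : 0 < b := by positivity
  have hc0 : 0 < c := by positivity
  have hbc : b < c := by rw [hb, hcdef]; gcongr; exact half_lt_self hε
  have h1 : orliczNorm Φ ((b : ℝ)⁻¹ • u) ≤ 1 := by
    rw [orliczNorm_smul, ← ha]
    have e : ‖(b : ℝ)⁻¹‖ₑ = ((b⁻¹ : ℝ≥0) : ℝ≥0∞) := by simp [enorm_eq_nnnorm]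
    rw [e]
    norm_cast
    rw [inv_mul_le_iff₀ hb0, mul_one]
    exact le_self_add
  have h2 := modular_smul_le_one ((moSpace hΦ).smul_mem _ hu) h1 (s := b / c)
    ((div_lt_one₀ hc0).2 hbc)
  have e : ((b / c : ℝ≥0) : ℝ) • ((b : ℝ)⁻¹ • u) = (c : ℝ)⁻¹ • u := by
    rw [smul_smul]
    congr 1
    have : (b : ℝ) ≠ 0 := by exact_mod_cast hb0.ne'
    push_cast
    field_simp
  rw [e] at h2
  have := luxNorm_le_ofReal (by exact_mod_cast hc0) h2
  rwa [ENNReal.ofReal_coe_nnreal, hcdef, ENNReal.coe_add] at this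

end Norms

/-! ### Positive parts and purely singular functionals -/

section Singular

variable {T : Type*} [MeasurableSpace T] {μ : Measure T} {Φ : T → ℝ≥0∞ → ℝ≥0∞}

instance isOrderedAddMonoid_aeEqFun : IsOrderedAddMonoid (T →ₘ[μ] ℝ) where
  add_le_add_left f g h c := by
    rw [← AEEqFun.coeFn_le] at h ⊢
    filter_upwards [h, AEEqFun.coeFn_add f c, AEEqFun.coeFn_add g c] with t h1 h2 h3
    rw [h2, h3, Pi.add_apply, Pi.add_apply]
    gcongr

theorem mem_moSpace_of_neg_le_of_le {hΦ : IsMusielakOrlicz μ Φ} {a x : T →ₘ[μ] ℝ}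
    (ha : a ∈ moSpace hΦ) (h1 : -a ≤ x) (h2 : x ≤ a) : x ∈ moSpace hΦ := by
  refine mem_moSpace_of_enorm_le hΦ ha ?_
  rw [← AEEqFun.coeFn_le] at h1 h2
  filter_upwards [h1, h2, AEEqFun.coeFn_neg a] with t h1 h2 h3
  rw [h3, Pi.neg_apply] at h1
  rw [enorm_le_iff_norm_le, Real.norm_eq_abs, Real.norm_eq_abs]
  exact (abs_le.2 ⟨h1, h2⟩).trans (le_abs_self _)

theorem mem_moSpace_of_nonneg_of_le {hΦ : IsMusielakOrlicz μ Φ} {a x : T →ₘ[μ] ℝ}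
    (ha : a ∈ moSpace hΦ) (h1 : 0 ≤ x) (h2 : x ≤ a) : x ∈ moSpace hΦ :=
  mem_moSpace_of_neg_le_of_le ha ((neg_nonpos.2 (h1.trans h2)).trans h1) h2

theorem ae_enorm_le_of_nonneg_of_le {a x : T →ₘ[μ] ℝ} (h1 : 0 ≤ x) (h2 : x ≤ a) :
    ∀ᵐ t ∂μ, ‖x t‖ₑ ≤ ‖a t‖ₑ := by
  rw [← AEEqFun.coeFn_le] at h1 h2
  filter_upwards [h1, h2, AEEqFun.coeFn_zero (α := T) (β := ℝ) (μ := μ)] with t h1 h2 h3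
  rw [h3, Pi.zero_apply] at h1
  rw [enorm_le_iff_norm_le, Real.norm_eq_abs, Real.norm_eq_abs]
  exact abs_le_abs_of_nonneg h1 h2

theorem IncreasesTo.le {w : ℕ → T →ₘ[μ] ℝ} {u : T →ₘ[μ] ℝ} (h : IncreasesTo w u) (n : ℕ) :
    w n ≤ u := by
  rw [← AEEqFun.coeFn_le]
  have hm : ∀ᵐ t ∂μ, ∀ k, w n t ≤ w (n + k) t :=
    ae_all_iff.2 fun k => AEEqFun.coeFn_le.2 (h.1 (Nat.le_add_right n k))
  filter_upwards [hm, h.2] with t h1 h2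
  refine ge_of_tendsto h2 (eventually_atTop.2 ⟨n, fun m hm => ?_⟩)
  obtain ⟨k, rfl⟩ := Nat.exists_eq_add_of_le hm
  exact h1 k

theorem IncreasesTo.const (u : T →ₘ[μ] ℝ) : IncreasesTo (fun _ => u) u :=
  ⟨monotone_const, ae_of_all _ fun _ => tendsto_const_nhds⟩

theorem IncreasesTo.add_const {w : ℕ → T →ₘ[μ] ℝ} {u : T →ₘ[μ] ℝ} (h : IncreasesTo w u)
    (v : T →ₘ[μ] ℝ) : IncreasesTo (fun n => w n + v) (u + v) := by
  refine ⟨fun n m hnm => add_le_add (h.1 hnm) le_rfl, ?_⟩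
  filter_upwards [h.2, ae_all_iff.2 fun n => AEEqFun.coeFn_add (w n) v, AEEqFun.coeFn_add u v]
    with t h1 h2 h3
  simp only [h2, h3, Pi.add_apply]
  exact h1.add_const _

theorem IncreasesTo.inf {w v : ℕ → T →ₘ[μ] ℝ} {u : T →ₘ[μ] ℝ} (hw : IncreasesTo w u)
    (hv : IncreasesTo v u) : IncreasesTo (fun n => w n ⊓ v n) u := by
  refine ⟨fun n m hnm => inf_le_inf (hw.1 hnm) (hv.1 hnm), ?_⟩
  filter_upwards [hw.2, hv.2, ae_all_iff.2 fun n => AEEqFun.coeFn_inf (w n) (v n)] with t h1 h2 h3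
  simp only [h3]
  simpa using h1.min h2

variable {hΦ : IsMusielakOrlicz μ Φ} {f : moSpace hΦ →ₗ[ℝ] ℝ}

theorem InDual.neg (hf : InDual f) : InDual (-f) := by
  obtain ⟨C, hC⟩ := hf
  exact ⟨C, fun u => by simpa using hC u⟩

theorem InDual.bddAbove (hf : InDual f) (u : moSpace hΦ) : BddAbove (f '' Set.Icc 0 u) := by
  obtain ⟨C, hC⟩ := hf
  refine ⟨(C * luxNorm Φ (u : T →ₘ[μ] ℝ)).toReal, ?_⟩
  rintro _ ⟨w, ⟨hw0, hwu⟩, rfl⟩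
  have h1 : ‖f w‖ₑ ≤ C * luxNorm Φ (u : T →ₘ[μ] ℝ) := by
    refine (hC w).trans ?_
    gcongr
    exact luxNorm_mono hΦ (ae_enorm_le_of_nonneg_of_le hw0 hwu)
  have h2 : C * luxNorm Φ (u : T →ₘ[μ] ℝ) ≠ ∞ :=
    ENNReal.mul_ne_top ENNReal.coe_ne_top (luxNorm_ne_top hΦ u.2)
  have h3 := ENNReal.toReal_mono h2 h1
  rw [toReal_enorm] at h3
  exact (Real.le_norm_self _).trans h3

theorem InDual.le_posPart (hf : InDual f) {w u : moSpace hΦ} (h0 : 0 ≤ w) (hwu : w ≤ u) :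
    f w ≤ posPart f u :=
  le_csSup (hf.bddAbove u) ⟨w, ⟨h0, hwu⟩, rfl⟩

theorem posPart_le {u : moSpace hΦ} (hu : 0 ≤ u) {c : ℝ}
    (h : ∀ w, 0 ≤ w → w ≤ u → f w ≤ c) : posPart f u ≤ c := by
  refine csSup_le ⟨f 0, 0, ⟨le_rfl, hu⟩, rfl⟩ ?_
  rintro _ ⟨w, ⟨h0, hwu⟩, rfl⟩
  exact h w h0 hwu

theorem InDual.posPart_nonneg (hf : InDual f) {u : moSpace hΦ} (hu : 0 ≤ u) :
    0 ≤ posPart f u := by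
  simpa using hf.le_posPart le_rfl hu

theorem InDual.posPart_mono (hf : InDual f) {u v : moSpace hΦ} (hu : 0 ≤ u) (huv : u ≤ v) :
    posPart f u ≤ posPart f v :=
  posPart_le hu fun _ h0 hw => hf.le_posPart h0 (hw.trans huv)

/-- Riesz decomposition: w ≤ a + b splits as w ⊓ a plus a remainder below b. -/
theorem InDual.posPart_add_le (hf : InDual f) {a b : moSpace hΦ} (ha : 0 ≤ a) (hb : 0 ≤ b) :
    posPart f (a + b) ≤ posPart f a + posPart f b := by
  refine posPart_le (add_nonneg ha hb) fun w h0 hw => ?_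
  have hx0 : (0 : T →ₘ[μ] ℝ) ≤ (w : T →ₘ[μ] ℝ) ⊓ a := le_inf h0 ha
  let x : moSpace hΦ := ⟨(w : T →ₘ[μ] ℝ) ⊓ a, mem_moSpace_of_nonneg_of_le a.2 hx0 inf_le_right⟩
  have hxw : x ≤ w := inf_le_left (a := (w : T →ₘ[μ] ℝ))
  have hxa : x ≤ a := inf_le_right (a := (w : T →ₘ[μ] ℝ))
  have hwx : w - x ≤ b := by
    rw [sub_le_comm]
    exact le_inf (sub_le_self (w : T →ₘ[μ] ℝ) hb) (sub_le_iff_le_add.2 hw)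
  have h1 := hf.le_posPart hx0 hxa
  have h2 := hf.le_posPart (sub_nonneg.2 hxw) hwx
  rw [map_sub] at h2
  linarith

/-- Translation by a moves x into [0, 2a]. The constant is crude, but only subadditivity of the
positive parts is needed. -/
theorem InDual.abs_le (hf : InDual f) {a x : moSpace hΦ} (h1 : -a ≤ x) (h2 : x ≤ a) (ha : 0 ≤ a) :
    |f x| ≤ 2 * (posPart f a + posPart (-f) a) := by
  have hp := hf.posPart_nonneg ha
  have hm := hf.neg.posPart_nonneg ha
  have hx0 : 0 ≤ x + a := neg_le_iff_add_nonneg.1 h1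
  have hxa : x + a ≤ a + a := by gcongr
  have k1 := (hf.le_posPart hx0 hxa).trans (hf.posPart_add_le ha ha)
  have k2 := (hf.neg.le_posPart hx0 hxa).trans (hf.neg.posPart_add_le ha ha)
  have k3 := hf.le_posPart ha le_rfl
  have k4 := hf.neg.le_posPart ha le_rfl
  simp only [LinearMap.neg_apply, map_add] at k1 k2 k3 k4
  rw [_root_.abs_le]
  constructor <;> linarith

theorem InDual.bddBelow_ocPos (hf : InDual f) (u : moSpace hΦ) :
    BddBelow {x | ∃ w : ℕ → moSpace hΦ, (∀ n, 0 ≤ w n) ∧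
      IncreasesTo (fun n => (w n : T →ₘ[μ] ℝ)) (u : T →ₘ[μ] ℝ) ∧
      x = ⨆ n, posPart f (w n)} := by
  refine ⟨0, ?_⟩
  rintro _ ⟨w, hw, -, rfl⟩
  exact Real.iSup_nonneg fun n => hf.posPart_nonneg (hw n)

theorem InDual.ocPos_le (hf : InDual f) {u : moSpace hΦ} (hu : 0 ≤ u) :
    ocPos (posPart f) u ≤ posPart f u :=
  csInf_le (hf.bddBelow_ocPos u) ⟨fun _ => u, fun _ => hu, IncreasesTo.const _, by simp⟩

theorem InDual.exists_of_ocPos_lt (hf : InDual f) {u : moSpace hΦ} (hu : 0 ≤ u) {c : ℝ}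
    (h : ocPos (posPart f) u < c) :
    ∃ w : ℕ → moSpace hΦ, (∀ n, 0 ≤ w n) ∧
      IncreasesTo (fun n => (w n : T →ₘ[μ] ℝ)) (u : T →ₘ[μ] ℝ) ∧ ∀ n, posPart f (w n) ≤ c := by
  obtain ⟨_, ⟨w, hw, hinc, rfl⟩, hlt⟩ := exists_lt_of_csInf_lt
    (s := {x | ∃ w : ℕ → moSpace hΦ, (∀ n, 0 ≤ w n) ∧
      IncreasesTo (fun n => (w n : T →ₘ[μ] ℝ)) (u : T →ₘ[μ] ℝ) ∧ x = ⨆ n, posPart f (w n)})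
    ⟨_, fun _ => u, fun _ => hu, IncreasesTo.const _, rfl⟩ h
  refine ⟨w, hw, hinc, fun n => le_trans (le_ciSup (f := fun n => posPart f (w n)) ?_ n) hlt.le⟩
  refine ⟨posPart f u, ?_⟩
  rintro _ ⟨k, rfl⟩
  exact hf.posPart_mono (hw k) (hinc.le k)

/-- If `v ≤ u` carries little of `f⁻`, `u - v` little of `f⁺`, and `(f⁺)_c ≤ (f⁻)_c`, then `u` is
the limit of an increasing sequence on which `f⁺` is small. -/
theorem InDual.exists_increasesTo_posPart_le (hf : InDual f) {u v : moSpace hΦ} {ε : ℝ}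
    (hε : 0 < ε) (hv0 : 0 ≤ v) (hvu : v ≤ u)
    (hoc : ocPos (posPart f) v ≤ ocPos (posPart (-f)) v)
    (hm : posPart (-f) v ≤ ε) (hp : posPart f (u - v) ≤ ε) :
    ∃ a : ℕ → moSpace hΦ, (∀ n, 0 ≤ a n) ∧
      IncreasesTo (fun n => (a n : T →ₘ[μ] ℝ)) (u : T →ₘ[μ] ℝ) ∧
      ∀ n, posPart f (a n) ≤ 3 * ε := by
  have h1 : ocPos (posPart f) v < 2 * ε := by
    have := (hoc.trans (hf.neg.ocPos_le hv0)).trans hm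
    linarith
  obtain ⟨a, ha0, hinc, ha⟩ := hf.exists_of_ocPos_lt hv0 h1
  have huv : 0 ≤ u - v := sub_nonneg.2 hvu
  refine ⟨fun n => a n + (u - v), fun n => add_nonneg (ha0 n) huv, ?_, fun n => ?_⟩
  · have := hinc.add_const ((u - v : moSpace hΦ) : T →ₘ[μ] ℝ)
    simpa using this
  · have := hf.posPart_add_le (ha0 n) huv
    have := ha n
    linarith

/-- Pure singularity as defined only says (f⁺)_c = (f⁻)_c. An approximate Hahn decomposition
separates them: a v that nearly attains f⁺(u) carries little of f⁻, and u - v little of f⁺. Hence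
(f⁺)_c is small at v and (f⁻)_c at u - v; the two resulting sequences are combined by their infimum.
-/
theorem IsPurelySingular.exists_increasesTo (hf : IsPurelySingular f) {u : moSpace hΦ} (hu : 0 ≤ u)
    {ε : ℝ} (hε : 0 < ε) :
    ∃ a : ℕ → moSpace hΦ, (∀ n, 0 ≤ a n) ∧
      IncreasesTo (fun n => (a n : T →ₘ[μ] ℝ)) (u : T →ₘ[μ] ℝ) ∧
      ∀ n, posPart f (a n) ≤ ε ∧ posPart (-f) (a n) ≤ ε := by
  obtain ⟨hd, hs⟩ := hf
  have hε3 : 0 < ε / 3 := by positivity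
  obtain ⟨_, ⟨v, ⟨hv0, hvu⟩, rfl⟩, hlt⟩ := exists_lt_of_lt_csSup
    (s := f '' Set.Icc 0 u) ⟨f 0, 0, ⟨le_rfl, hu⟩, rfl⟩ (sub_lt_self (posPart f u) hε3)
  have hoc : ∀ w : moSpace hΦ, 0 ≤ w → ocPos (posPart f) w = ocPos (posPart (-f)) w :=
    fun w hw => sub_eq_zero.1 (hs w hw)
  have huv : 0 ≤ u - v := sub_nonneg.2 hvu
  have hm : posPart (-f) v ≤ ε / 3 := by
    refine posPart_le hv0 fun w h0 hw => ?_
    have := hd.le_posPart (sub_nonneg.2 hw) ((sub_le_self v h0).trans hvu)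
    rw [map_sub] at this
    rw [LinearMap.neg_apply]
    linarith
  have hp : posPart f (u - v) ≤ ε / 3 := by
    refine posPart_le huv fun w h0 hw => ?_
    have := hd.le_posPart (add_nonneg h0 hv0) (le_sub_iff_add_le.1 hw)
    rw [map_add] at this
    linarith
  obtain ⟨a, ha0, hainc, ha⟩ := hd.exists_increasesTo_posPart_le hε3 hv0 hvu (hoc v hv0).le hm hp
  obtain ⟨b, hb0, hbinc, hb⟩ := hd.neg.exists_increasesTo_posPart_le (u := u) (v := u - v) hε3 huv
    (sub_le_self u hv0) (by rw [neg_neg]; exact (hoc _ huv).ge) (by rw [neg_neg]; exact hp)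
    (by rw [sub_sub_cancel]; exact hm)
  have h0 : ∀ n, (0 : T →ₘ[μ] ℝ) ≤ (a n : T →ₘ[μ] ℝ) ⊓ b n := fun n => le_inf (ha0 n) (hb0 n)
  let c : ℕ → moSpace hΦ := fun n =>
    ⟨(a n : T →ₘ[μ] ℝ) ⊓ b n, mem_moSpace_of_nonneg_of_le (a n).2 (h0 n) inf_le_left⟩
  have hca : ∀ n, c n ≤ a n := fun n => inf_le_left (a := (a n : T →ₘ[μ] ℝ))
  have hcb : ∀ n, c n ≤ b n := fun n => inf_le_right (a := (a n : T →ₘ[μ] ℝ))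
  refine ⟨c, h0, hainc.inf hbinc, fun n => ⟨?_, ?_⟩⟩
  · have := (hd.posPart_mono (h0 n) (hca n)).trans (ha n)
    linarith
  · have := (hd.neg.posPart_mono (h0 n) (hcb n)).trans (hb n)
    linarith

/-- A purely singular functional is almost determined by the tails of a function: `u = x n + z n`
with `f (x n)` small and `|z n| ↓ 0`. -/
theorem IsPurelySingular.exists_tail (hf : IsPurelySingular f) (u : moSpace hΦ) {ε : ℝ}
    (hε : 0 < ε) :
    ∃ (z : ℕ → moSpace hΦ) (w : ℕ → T →ₘ[μ] ℝ), (∀ n, |f u - f (z n)| ≤ ε) ∧ (∀ n, 0 ≤ w n) ∧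
      (∀ n, w n ≤ |(u : T →ₘ[μ] ℝ)|) ∧ DecreasesToZero w ∧
      ∀ n, ∀ᵐ t ∂μ, ‖(z n : T →ₘ[μ] ℝ) t‖ₑ = ‖w n t‖ₑ := by
  have habs : |(u : T →ₘ[μ] ℝ)| ∈ moSpace hΦ := by
    refine mem_moSpace_of_enorm_le hΦ u.2 ?_
    filter_upwards [AEEqFun.coeFn_abs (u : T →ₘ[μ] ℝ)] with t h
    rw [h]; simp [enorm_eq_nnnorm]
  -- ε / 4, because `InDual.abs_le` yields 2 (ε / 4 + ε / 4) = ε.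
  obtain ⟨a, ha0, hinc, ha⟩ := hf.exists_increasesTo (u := ⟨_, habs⟩)
    (abs_nonneg (u : T →ₘ[μ] ℝ)) (by positivity : 0 < ε / 4)
  have hau : ∀ n, (a n : T →ₘ[μ] ℝ) ≤ |(u : T →ₘ[μ] ℝ)| := hinc.le
  have h1 : ∀ n, -(a n : T →ₘ[μ] ℝ) ≤ ((u : T →ₘ[μ] ℝ) ⊓ a n) ⊔ -(a n : T →ₘ[μ] ℝ) :=
    fun n => le_sup_right
  have h2 : ∀ n, ((u : T →ₘ[μ] ℝ) ⊓ a n) ⊔ -(a n : T →ₘ[μ] ℝ) ≤ a n :=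
    fun n => sup_le inf_le_right (neg_le_self (ha0 n))
  -- x n is u clamped to [-a n, a n]; as 0 ≤ a n ≤ |u|, this leaves |u - x n| = |u| - a n.
  let x : ℕ → moSpace hΦ := fun n => ⟨((u : T →ₘ[μ] ℝ) ⊓ a n) ⊔ -(a n : T →ₘ[μ] ℝ),
    mem_moSpace_of_neg_le_of_le (a n).2 (h1 n) (h2 n)⟩
  refine ⟨fun n => u - x n, fun n => |(u : T →ₘ[μ] ℝ)| - a n, fun n => ?_, fun n => ?_,
    fun n => ?_, ⟨fun n m hnm => ?_, ?_⟩, fun n => ?_⟩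
  · rw [map_sub, sub_sub_cancel]
    have := hf.1.abs_le (a := a n) (x := x n) (h1 n) (h2 n) (ha0 n)
    have := ha n
    linarith
  · exact sub_nonneg.2 (hau n)
  · exact sub_le_self _ (ha0 n)
  · exact sub_le_sub_left (hinc.1 hnm) _
  · filter_upwards [hinc.2, ae_all_iff.2 fun n =>
      AEEqFun.coeFn_sub |(u : T →ₘ[μ] ℝ)| (a n : T →ₘ[μ] ℝ)] with t h3 h4
    simp only [h4, Pi.sub_apply]
    simpa using h3.const_sub (|(u : T →ₘ[μ] ℝ)| t)
  · filter_upwards [AEEqFun.coeFn_sub |(u : T →ₘ[μ] ℝ)| (a n : T →ₘ[μ] ℝ),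
      AEEqFun.coeFn_sub (u : T →ₘ[μ] ℝ) (x n : T →ₘ[μ] ℝ), AEEqFun.coeFn_abs (u : T →ₘ[μ] ℝ),
      AEEqFun.coeFn_sup ((u : T →ₘ[μ] ℝ) ⊓ a n) (-(a n : T →ₘ[μ] ℝ)),
      AEEqFun.coeFn_inf (u : T →ₘ[μ] ℝ) (a n : T →ₘ[μ] ℝ), AEEqFun.coeFn_neg (a n : T →ₘ[μ] ℝ),
      AEEqFun.coeFn_le.2 (ha0 n), AEEqFun.coeFn_le.2 (hau n),
      AEEqFun.coeFn_zero (α := T) (β := ℝ) (μ := μ)] with t e1 e2 e3 e4 e5 e6 e7 e8 e9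
    have e10 : ((u - x n : moSpace hΦ) : T →ₘ[μ] ℝ) t
        = (u : T →ₘ[μ] ℝ) t - max (min ((u : T →ₘ[μ] ℝ) t) ((a n : T →ₘ[μ] ℝ) t))
          (-(a n : T →ₘ[μ] ℝ) t) := by
      rw [Submodule.coe_sub, e2, Pi.sub_apply]
      congr 1
      rw [e4, e5, e6]
      rfl
    rw [e10, e1, Pi.sub_apply, e3]
    change (0 : T →ₘ[μ] ℝ) t ≤ (a n : T →ₘ[μ] ℝ) t at e7
    rw [e9, Pi.zero_apply] at e7
    rw [e3] at e8
    generalize (u : T →ₘ[μ] ℝ) t = U at *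
    generalize (a n : T →ₘ[μ] ℝ) t = A at *
    suffices h : |U - max (min U A) (-A)| = |(|U| - A)| by
      rw [← ofReal_norm, ← ofReal_norm, Real.norm_eq_abs, Real.norm_eq_abs, h]
    rw [abs_of_nonneg (sub_nonneg.2 e8)]
    rcases le_total 0 U with hU | hU
    · rw [abs_of_nonneg hU] at e8 ⊢
      rw [min_eq_right e8, max_eq_left (by linarith), abs_of_nonneg (by linarith)]
    · rw [abs_of_nonpos hU] at e8 ⊢
      rw [min_eq_left (by linarith), max_eq_right (by linarith), abs_of_nonpos (by linarith)]
      ring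

end Singular

/-! ### Comparison of the dual norms -/

section DualNorms

variable {T : Type*} [MeasurableSpace T] {μ : Measure T} {Φ : T → ℝ≥0∞ → ℝ≥0∞}

theorem DecreasesToZero.tendsto_modular (hΦ : IsMusielakOrlicz μ Φ) {w : ℕ → T →ₘ[μ] ℝ}
    {u : T →ₘ[μ] ℝ} (hw : DecreasesToZero w) (hle : ∀ n, ∀ᵐ t ∂μ, ‖w n t‖ₑ ≤ ‖u t‖ₑ)
    (hu : modular Φ u ≠ ∞) : Tendsto (fun n => modular Φ (w n)) atTop (𝓝 0) := by
  have h0 : ∫⁻ _ : T, (0 : ℝ≥0∞) ∂μ = 0 := lintegral_zero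
  rw [← h0]
  refine tendsto_lintegral_of_dominated_convergence' (fun t => Φ t ‖u t‖ₑ)
    (fun n => hΦ.aemeasurable_comp (w n)) (fun n => ?_) hu ?_
  · filter_upwards [hle n, hΦ.ae_mono] with t h1 hm
    exact hm h1
  · filter_upwards [hw.2, hΦ.tendsto_zero, hΦ.map_zero] with t h1 h2 h3
    -- The tails may reach the value 0, so the one-sided limit is completed by Φ(t, 0) = 0.
    have hc : Tendsto (Φ t) (𝓝 0) (𝓝 0) := by
      have e : (𝓝 (0 : ℝ≥0∞)) = pure 0 ⊔ 𝓝[>] 0 := by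
        rw [← nhdsNE_sup_pure, sup_comm]
        congr 2
        ext x
        simp [pos_iff_ne_zero]
      have hp : Tendsto (Φ t) (pure 0) (𝓝 0) := by
        simpa only [h3] using tendsto_pure_nhds (Φ t) 0
      have := hp.sup h2
      rwa [← e] at this
    exact hc.comp (by simpa using h1.enorm)

variable {hΦ : IsMusielakOrlicz μ Φ} {f : moSpace hΦ →ₗ[ℝ] ℝ}

/-- The case N u = 0 is included: a finite supremum then forces f u = 0. -/
theorem enorm_le_iSup_div_mul (N : moSpace hΦ → ℝ≥0∞) {u : moSpace hΦ} (htop : N u ≠ ∞)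
    (hfin : (⨆ u, ‖f u‖ₑ / N u) ≠ ∞) : ‖f u‖ₑ ≤ (⨆ u, ‖f u‖ₑ / N u) * N u := by
  have h : ‖f u‖ₑ / N u ≤ ⨆ u, ‖f u‖ₑ / N u := le_iSup (fun u => ‖f u‖ₑ / N u) u
  exact (ENNReal.div_le_iff_le_mul (Or.inr hfin) (Or.inl htop)).1 h

theorem DecreasesToZero.nonneg {w : ℕ → T →ₘ[μ] ℝ} (hw : DecreasesToZero w) (n : ℕ) :
    0 ≤ w n := by
  have h : IncreasesTo (fun n => -w n) (0 : T →ₘ[μ] ℝ) := by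
    refine ⟨fun n m hnm => neg_le_neg (hw.1 hnm), ?_⟩
    filter_upwards [hw.2, ae_all_iff.2 fun n => AEEqFun.coeFn_neg (w n),
      AEEqFun.coeFn_zero (α := T) (β := ℝ) (μ := μ)] with t h1 h2 h3
    simp only [h2, h3, Pi.neg_apply, Pi.zero_apply]
    simpa using h1.neg
  exact neg_nonpos.1 (h.le n)

theorem ae_enorm_le_of_nonneg_of_le_abs {w u : T →ₘ[μ] ℝ} (h0 : 0 ≤ w) (h : w ≤ |u|) :
    ∀ᵐ t ∂μ, ‖w t‖ₑ ≤ ‖u t‖ₑ := by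
  filter_upwards [ae_enorm_le_of_nonneg_of_le h0 h, AEEqFun.coeFn_abs u] with t h1 h2
  rwa [h2, Real.enorm_abs] at h1

theorem IsPurelySingular.exists_tail_enorm (hf : IsPurelySingular f) (u : moSpace hΦ) {ε : ℝ≥0}
    (hε : 0 < ε) :
    ∃ (z : ℕ → moSpace hΦ) (w : ℕ → T →ₘ[μ] ℝ), (∀ n, ‖f u‖ₑ ≤ ‖f (z n)‖ₑ + ε) ∧
      (∀ n, w n ≤ |(u : T →ₘ[μ] ℝ)|) ∧ DecreasesToZero w ∧
      (∀ n, ∀ᵐ t ∂μ, ‖w n t‖ₑ ≤ ‖(u : T →ₘ[μ] ℝ) t‖ₑ) ∧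
      ∀ n, ∀ᵐ t ∂μ, ‖(z n : T →ₘ[μ] ℝ) t‖ₑ = ‖w n t‖ₑ := by
  obtain ⟨z, w, h1, h2, h3, h4, h5⟩ := hf.exists_tail u (ε := ε) (by exact_mod_cast hε)
  refine ⟨z, w, fun n => ?_, h3, h4, fun n => ae_enorm_le_of_nonneg_of_le_abs (h2 n) (h3 n), h5⟩
  calc ‖f u‖ₑ = ‖f (z n) + (f u - f (z n))‖ₑ := by rw [add_sub_cancel]
    _ ≤ ‖f (z n)‖ₑ + ‖f u - f (z n)‖ₑ := enorm_add_le _ _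
    _ ≤ ‖f (z n)‖ₑ + ε := by
        gcongr
        rw [← ofReal_norm, Real.norm_eq_abs, ← ENNReal.ofReal_coe_nnreal]
        exact ENNReal.ofReal_le_ofReal (h1 n)

/-- For a purely singular functional, a monotone norm `N` and its tail version define the same dual
norm. -/
theorem IsPurelySingular.iSup_div_eq_iSup_div_tail (hf : IsPurelySingular f)
    {N : (T →ₘ[μ] ℝ) → ℝ≥0∞} (htop : ∀ u ∈ moSpace hΦ, N u ≠ ∞)
    (hmono : ∀ u ∈ moSpace hΦ, ∀ w : T →ₘ[μ] ℝ, (∀ᵐ t ∂μ, ‖w t‖ₑ ≤ ‖u t‖ₑ) → N w ≤ N u) :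
    (⨆ u : moSpace hΦ, ‖f u‖ₑ / N u) = ⨆ u : moSpace hΦ, ‖f u‖ₑ /
      ⨆ (w : ℕ → T →ₘ[μ] ℝ) (_ : ∀ n, w n ≤ |(u : T →ₘ[μ] ℝ)|) (_ : DecreasesToZero w),
        ⨅ n, N (w n) := by
  have hq : ∀ u : moSpace hΦ, (⨆ (w : ℕ → T →ₘ[μ] ℝ) (_ : ∀ n, w n ≤ |(u : T →ₘ[μ] ℝ)|)
      (_ : DecreasesToZero w), ⨅ n, N (w n)) ≤ N u := fun u =>
    iSup_le fun w => iSup_le fun hle => iSup_le fun hw => (iInf_le _ 0).trans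
      (hmono u u.2 _ (ae_enorm_le_of_nonneg_of_le_abs (hw.nonneg 0) (hle 0)))
  apply le_antisymm
  · exact iSup_mono fun u => ENNReal.div_le_div_left (hq u) _
  · rcases eq_or_ne (⨆ u : moSpace hΦ, ‖f u‖ₑ / N u) ∞ with hD | hD
    · rw [hD]; exact le_top
    refine iSup_le fun u => ENNReal.div_le_of_le_mul ?_
    refine ENNReal.le_of_forall_pos_le_add fun ε hε _ => ?_
    obtain ⟨z, w, hz, hwu, hw, hwe, hzw⟩ := hf.exists_tail_enorm u hε
    -- Dividing by the dual norm D rather than by Q(u) reduces the claim to (|f u| - ε) / D ≤ N (w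
    -- n) for all n, for one tail sequence w.
    rw [← tsub_le_iff_right, mul_comm]
    refine (ENNReal.div_le_iff_le_mul (Or.inr (ne_top_of_le_ne_top (htop u u.2) (hq u)))
      (Or.inl hD)).1 ?_
    refine le_iSup_of_le w (le_iSup₂_of_le hwu hw (le_iInf fun n => ?_))
    refine ENNReal.div_le_of_le_mul' (tsub_le_iff_right.2 ((hz n).trans ?_))
    gcongr
    refine (enorm_le_iSup_div_mul (fun u : moSpace hΦ => N u) (htop _ (z n).2) hD).trans ?_
    gcongr
    exact hmono _ (mem_moSpace_of_enorm_le hΦ u.2 (hwe n)) _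
      ((hzw n).mono fun t h => h.le)

/-- A purely singular functional is bounded on functions of finite modular by its dual norm with
respect to any monotone norm `N ≤ I_Φ + 1`. -/
theorem IsPurelySingular.enorm_le_iSup_div (hf : IsPurelySingular f)
    {N : (T →ₘ[μ] ℝ) → ℝ≥0∞} (hN : ∀ u ∈ moSpace hΦ, N u ≤ modular Φ u + 1) {u : moSpace hΦ}
    (hu : modular Φ (u : T →ₘ[μ] ℝ) < ∞) : ‖f u‖ₑ ≤ ⨆ u : moSpace hΦ, ‖f u‖ₑ / N u := by
  rcases eq_or_ne (⨆ u : moSpace hΦ, ‖f u‖ₑ / N u) ∞ with hD | hD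
  · rw [hD]; exact le_top
  refine ENNReal.le_of_forall_pos_le_add fun ε hε _ => ?_
  obtain ⟨z, w, hz, hwu, hw, hwe, hzw⟩ := hf.exists_tail_enorm u hε
  have hlim := hw.tendsto_modular hΦ hwe hu.ne
  set D := ⨆ u : moSpace hΦ, ‖f u‖ₑ / N u with hDdef
  have hlim2 : Tendsto (fun n => D * (modular Φ (w n) + 1) + ε) atTop (𝓝 (D * (0 + 1) + ε)) :=
    (ENNReal.Tendsto.const_mul (hlim.add_const 1) (Or.inr hD)).add_const _
  rw [zero_add, mul_one] at hlim2
  refine ge_of_tendsto' hlim2 fun n => (hz n).trans ?_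
  have hzm : modular Φ (z n : T →ₘ[μ] ℝ) = modular Φ (w n) := by
    refine lintegral_congr_ae ?_
    filter_upwards [hzw n] with t h
    rw [h]
  have hfin : N (z n) ≠ ∞ := by
    refine ne_top_of_le_ne_top ?_ (hN _ (z n).2)
    rw [hzm]
    exact ENNReal.add_ne_top.2
      ⟨ne_top_of_le_ne_top hu.ne (modular_mono hΦ (hwe n)), ENNReal.one_ne_top⟩
  gcongr
  refine (enorm_le_iSup_div_mul (fun u : moSpace hΦ => N u) hfin hD).trans ?_
  rw [← hDdef, ← hzm]
  gcongr
  exact hN _ (z n).2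

/-- If I_Φ(u / r) < ∞ then |f(u)| = r |f(u / r)| ≤ r M; the infimum over r gives θ(u) M. -/
theorem iSup_div_theta_le :
    (⨆ u : moSpace hΦ, ‖f u‖ₑ / theta Φ (u : T →ₘ[μ] ℝ)) ≤
      ⨆ (u : moSpace hΦ) (_ : modular Φ (u : T →ₘ[μ] ℝ) < ∞), ‖f u‖ₑ := by
  set M := ⨆ (u : moSpace hΦ) (_ : modular Φ (u : T →ₘ[μ] ℝ) < ∞), ‖f u‖ₑ with hMdef
  rcases eq_or_ne M ∞ with hM | hM
  · rw [hM]; exact le_top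
  refine iSup_le fun u => ENNReal.div_le_of_le_mul ?_
  have hθ : theta Φ (u : T →ₘ[μ] ℝ) ≠ ∞ :=
    ne_top_of_le_ne_top (luxNorm_ne_top hΦ u.2) (theta_le_luxNorm _)
  rw [mul_comm]
  refine (ENNReal.div_le_iff_le_mul (Or.inr hθ) (Or.inl hM)).1 ?_
  refine le_iInf fun r => le_iInf fun hr => le_iInf fun hlt => ENNReal.div_le_of_le_mul' ?_
  have h1 : ‖f (r⁻¹ • u)‖ₑ ≤ M :=
    le_iSup₂ (f := fun (u : moSpace hΦ) (_ : modular Φ (u : T →ₘ[μ] ℝ) < ∞) => ‖f u‖ₑ) (r⁻¹ • u) hlt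
  calc ‖f u‖ₑ = ‖f (r • r⁻¹ • u)‖ₑ := by rw [smul_inv_smul₀ hr.ne']
    _ = ENNReal.ofReal r * ‖f (r⁻¹ • u)‖ₑ := by
        rw [map_smul, smul_eq_mul, enorm_mul, Real.enorm_of_nonneg hr.le]
    _ ≤ ENNReal.ofReal r * M := by gcongr
    _ = M * ENNReal.ofReal r := mul_comm _ _

theorem dualNormLux_le_iSup_div_theta (f : moSpace hΦ →ₗ[ℝ] ℝ) :
    dualNormLux f ≤ ⨆ u : moSpace hΦ, ‖f u‖ₑ / theta Φ (u : T →ₘ[μ] ℝ) :=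
  iSup_mono fun _ => ENNReal.div_le_div_left (theta_le_luxNorm _) _

theorem dualNormOrlicz_le_iSup_div_theta [SigmaFinite μ] (f : moSpace hΦ →ₗ[ℝ] ℝ) :
    dualNormOrlicz f ≤ ⨆ u : moSpace hΦ, ‖f u‖ₑ / theta Φ (u : T →ₘ[μ] ℝ) :=
  iSup_mono fun u => ENNReal.div_le_div_left
    ((theta_le_luxNorm _).trans (luxNorm_le_orliczNorm u.2)) _

theorem IsPurelySingular.iSup_enorm_le_dualNormLux [SigmaFinite μ] (hf : IsPurelySingular f) :
    (⨆ (u : moSpace hΦ) (_ : modular Φ (u : T →ₘ[μ] ℝ) < ∞), ‖f u‖ₑ) ≤ dualNormLux f :=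
  iSup₂_le fun _ hu => hf.enorm_le_iSup_div (fun u hu =>
    (luxNorm_le_orliczNorm hu).trans (orliczNorm_le_modular_add_one hΦ u)) hu

theorem IsPurelySingular.iSup_enorm_le_dualNormOrlicz (hf : IsPurelySingular f) :
    (⨆ (u : moSpace hΦ) (_ : modular Φ (u : T →ₘ[μ] ℝ) < ∞), ‖f u‖ₑ) ≤ dualNormOrlicz f :=
  iSup₂_le fun _ hu =>
    hf.enorm_le_iSup_div (fun u _ => orliczNorm_le_modular_add_one hΦ u) hu

end DualNorms

end MusielakOrlicz

theorem mainTheorem8 {T : Type*} [MeasurableSpace T] (μ : Measure T) [SigmaFinite μ]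
    (hμ : MusielakOrlicz.NonAtomic μ) (Φ : T → ℝ≥0∞ → ℝ≥0∞)
    (hΦ : MusielakOrlicz.IsMusielakOrlicz μ Φ)
    (f : MusielakOrlicz.moSpace hΦ →ₗ[ℝ] ℝ) (hf : MusielakOrlicz.IsPurelySingular f) :
    (MusielakOrlicz.dualNormLux f =
        (⨆ u : MusielakOrlicz.moSpace hΦ, ‖f u‖ₑ / MusielakOrlicz.qLux Φ (u : T →ₘ[μ] ℝ))) ∧
      (MusielakOrlicz.dualNormOrlicz f =
        (⨆ u : MusielakOrlicz.moSpace hΦ, ‖f u‖ₑ / MusielakOrlicz.qOrlicz Φ (u : T →ₘ[μ] ℝ))) ∧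
      (MusielakOrlicz.dualNormLux f = MusielakOrlicz.dualNormOrlicz f) ∧
      (MusielakOrlicz.dualNormOrlicz f =
        (⨆ (u : MusielakOrlicz.moSpace hΦ)
          (_ : MusielakOrlicz.modular Φ (u : T →ₘ[μ] ℝ) < ∞), ‖f u‖ₑ)) ∧
      (MusielakOrlicz.dualNormOrlicz f =
        (⨆ u : MusielakOrlicz.moSpace hΦ, ‖f u‖ₑ / MusielakOrlicz.theta Φ (u : T →ₘ[μ] ℝ))) := by
  have hMlux := hf.iSup_enorm_le_dualNormLux
  have hMorl := hf.iSup_enorm_le_dualNormOrlicz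
  have hluxθ := MusielakOrlicz.dualNormLux_le_iSup_div_theta f
  have horlθ := MusielakOrlicz.dualNormOrlicz_le_iSup_div_theta f
  have hθM := MusielakOrlicz.iSup_div_theta_le (f := f)
  refine ⟨?_, ?_, ?_, ?_, ?_⟩
  · exact hf.iSup_div_eq_iSup_div_tail (fun _ hu => MusielakOrlicz.luxNorm_ne_top hΦ hu)
      fun _ _ _ h => MusielakOrlicz.luxNorm_mono hΦ h
  · exact hf.iSup_div_eq_iSup_div_tail (fun _ hu => MusielakOrlicz.orliczNorm_ne_top hu)
      fun _ hu _ h => MusielakOrlicz.orliczNorm_mono hu h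
  · exact le_antisymm ((hluxθ.trans hθM).trans hMorl) ((horlθ.trans hθM).trans hMlux)
  · exact le_antisymm (horlθ.trans hθM) hMorl
  · exact le_antisymm horlθ (hθM.trans hMorl)
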